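/- Let $\mathbb F$ be a field, $\mathbb F^*=\mathbb F\cup\{\infty\}$, and let $m,p,g\ge 0$ be integers. Let $n(y),d(y)\in\mathbb F[y]$ be coprime, put $G=\max(\deg n,\deg d)$ and assume $G\ge 1$. Let $P(x)\in\mathbb F[x]^{m\times p}$ have grade $g$ (all entries have degree at most $g$), and let $Q(y)=d(y)^g\,P\!\left(\frac{n(y)}{d(y)}\right)\in\mathbb F[y]^{m\times p}$. Conventions. The invariant polynomials of a polynomial matrix are the diagonal entries (monic or zero, each dividing the next) of its Smith form under multiplication by unimodular matrices. Its elementary divisors at $x_0\in\mathbb F$ are the powers $(x-x_0)^{\ell}$ with $\ell\ge 1$, where $\ell$ runs over the positive multiplicities of $x_0$ as a root of the nonzero invariant polynomials (with repetitions). The elementary divisors $(x-\infty)^\ell$ at $\infty$ of a matrix considered with grade $g$ correspond to the elementary divisors $x^\ell$ at $0$ of its reversal $x^gP(x^{-1})$. A point of $\mathbb F^*$ is a characteristic value if there is at least one elementary divisor there. The right (left) minimal indices are the degrees of the vectors of a minimal basis of the kernel of the matrix (of its transpose) over the field of rational functions, i.e. of a basis of polynomial vectors whose sum of degrees is smallest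 possible. For $x_0\in\mathbb F^*$ write $x_0=\alpha/\beta$ with $(\alpha,\beta)=(x_0,1)$ if $x_0\in\mathbb F$ and $(\alpha,\beta)=(1,0)$ if $x_0=\infty$. Let $T_{x_0}\subseteq\mathbb F^*$ be the set of preimages of $x_0$ under $x(y)=n(y)/d(y)$; here a finite $y_0$ has multiplicity $m_0$ equal to its multiplicity as a root of $\alpha d(y)-\beta n(y)$, and $\infty\in T_{x_0}$ if and only if $S:=\deg(\alpha d-\beta n)<G$, with multiplicity $m_0=G-S$. The value $x(\infty)$ is the quotient of the coefficients of $y^G$ in $n$ and $d$, and values with denominator $0$ are $\infty$. Then $\deg Q\le gG$, and with $Q$ considered with grade $gG$ the following hold. 1. Let $x_0\in\mathbb F^*$ and $y_0\in T_{x_0}$, of multiplicity $m_0$. If $x_0$ is a characteristic value of $P$, then $y_0$ is a characteristic value of $Q$. If $(x-x_0)^{\ell_1},\dots,(x-x_0)^{\ell_j}$ ($j\ge 0$) are the elementary divisors of $P$ at $x_0$, then $(y-y_0)^{m_0\ell_1},\dots,(y-y_0)^{m_0\ell_j}$ are the elementary divisors of $Q$ at $y_0$. 2. Conversely, let $y_0\in\mathbb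 F^*$, and let $x_0=n(y_0)/d(y_0)\in\mathbb F^*$. Then $y_0\in T_{x_0}$; let $m_0$ be its multiplicity. If $y_0$ is a characteristic value of $Q$, then $x_0$ is a characteristic value of $P$. If $(y-y_0)^{\kappa_1},\dots,(y-y_0)^{\kappa_j}$ ($j\ge 0$) are the elementary divisors of $Q$ at $y_0$, then $m_0\mid\kappa_i$ for all $i$, and $(x-x_0)^{\kappa_1/m_0},\dots,(x-x_0)^{\kappa_j/m_0}$ are the elementary divisors of $P$ at $x_0$. 3. The right minimal indices of $P$ are $\beta_1,\dots,\beta_s$ if and only if the right minimal indices of $Q$ are $G\beta_1,\dots,G\beta_s$, and all right minimal indices of $Q$ are of this form. 4. The left minimal indices of $P$ are $\gamma_1,\dots,\gamma_r$ if and only if the left minimal indices of $Q$ are $G\gamma_1,\dots,G\gamma_r$, and all left minimal indices of $Q$ are of this form. -/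

import Mathlib

open Polynomial

namespace RatTransf

noncomputable section

variable {F : Type*} [Field F]

/-! ### Smith form, elementary divisors, characteristic values -/

/-- The (possibly rectangular) diagonal matrix `diag(δ₁, …, δ_ν)`, `ν = min m p`. -/
def rectDiag {R : Type*} [Zero R] {m p : ℕ} (δ : Fin (min m p) → R) : Matrix (Fin m) (Fin p) R :=
  fun i j => if h : (i : ℕ) = (j : ℕ) then δ ⟨i, lt_min i.2 (h ▸ j.2)⟩ else 0

/-- `δ₁, …, δ_ν` are the invariant polynomials of `P`: there are unimodular `A`, `B` such that
`A P B = diag(δ₁, …, δ_ν)` is in Smith form. An invariant polynomial is monic or zero. -/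
def IsInvariantPolynomials {m p : ℕ} (P : Matrix (Fin m) (Fin p) F[X])
    (δ : Fin (min m p) → F[X]) : Prop :=
  (∀ i, (δ i).Monic ∨ δ i = 0) ∧ (∀ i j, i ≤ j → δ i ∣ δ j) ∧
    ∃ (A : Matrix (Fin m) (Fin m) F[X]) (B : Matrix (Fin p) (Fin p) F[X]),
      IsUnit A.det ∧ IsUnit B.det ∧ A * P * B = rectDiag δ

/-- `(x - a)^ℓ₁, …, (x - a)^ℓⱼ` are (all) the elementary divisors of `P` at the finite point `a`,
where `L = {ℓ₁, …, ℓⱼ}` with repetitions: `L` collects the positive multiplicities of `a` as a root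
of the nonzero invariant polynomials (Mathlib's `rootMultiplicity a 0` is `0`, so that zero
invariant polynomials contribute nothing). -/
def HasFiniteElementaryDivisors {m p : ℕ} (P : Matrix (Fin m) (Fin p) F[X]) (a : F)
    (L : Multiset ℕ) : Prop :=
  ∃ δ : Fin (min m p) → F[X], IsInvariantPolynomials P δ ∧
    L = (Finset.univ.val.map fun i => (δ i).rootMultiplicity a).filter fun ℓ => 0 < ℓ

/-- `P` has grade `g`: all its entries have degree at most `g`. -/
def HasGrade {m p : ℕ} (P : Matrix (Fin m) (Fin p) F[X]) (g : ℕ) : Prop :=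
  ∀ i j, (P i j).natDegree ≤ g

/-- The reversal of `P` with respect to the grade `g`. (For entries of degree at most `g`,
`reflect g` sends `∑ aᵢ xⁱ` to `∑ a_{g-i} xⁱ`.) -/
def rev {m p : ℕ} (g : ℕ) (P : Matrix (Fin m) (Fin p) F[X]) : Matrix (Fin m) (Fin p) F[X] :=
  P.map (reflect g)

/-- The elementary divisors at a point of `F ∪ {∞}` of the matrix `P`, considered with grade `g`,
are `(x - x₀)^ℓ`, `ℓ ∈ L`. Those at `∞` are the ones of the reversal at `0`. -/
def HasElementaryDivisors {m p : ℕ} (P : Matrix (Fin m) (Fin p) F[X]) (g : ℕ) :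
    OnePoint F → Multiset ℕ → Prop
  | OnePoint.some a, L => HasFiniteElementaryDivisors P a L
  | OnePoint.infty, L => HasFiniteElementaryDivisors (rev g P) 0 L

/-- `x₀ ∈ F ∪ {∞}` is a characteristic value of `P` (with grade `g`). -/
def IsCharacteristicValue {m p : ℕ} (P : Matrix (Fin m) (Fin p) F[X]) (g : ℕ)
    (x₀ : OnePoint F) : Prop :=
  ∃ L : Multiset ℕ, HasElementaryDivisors P g x₀ L ∧ L ≠ 0

/-! ### Minimal bases and minimal indices -/

/-- A polynomial vector, regarded as a vector of rational functions. -/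
def toRat {p : ℕ} (v : Fin p → F[X]) : Fin p → RatFunc F :=
  fun j => algebraMap F[X] (RatFunc F) (v j)

/-- The degree of a polynomial vector: the largest degree of its entries. -/
def vecDegree {p : ℕ} (v : Fin p → F[X]) : ℕ :=
  Finset.univ.sup fun j => (v j).natDegree

/-- `v₁, …, v_s` is a polynomial basis of the subspace `V` of `F(x)^p`. -/
def IsPolynomialBasis {p s : ℕ} (V : Submodule (RatFunc F) (Fin p → RatFunc F))
    (v : Fin s → Fin p → F[X]) : Prop :=
  LinearIndependent (RatFunc F) (fun i => toRat (v i)) ∧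
    Submodule.span (RatFunc F) (Set.range fun i => toRat (v i)) = V

/-- The order of a polynomial basis: the sum of the degrees of its vectors. -/
def order {p s : ℕ} (v : Fin s → Fin p → F[X]) : ℕ :=
  ∑ i, vecDegree (v i)

/-- A minimal basis: a polynomial basis of minimal order. -/
def IsMinimalBasis {p s : ℕ} (V : Submodule (RatFunc F) (Fin p → RatFunc F))
    (v : Fin s → Fin p → F[X]) : Prop :=
  IsPolynomialBasis V v ∧ ∀ w : Fin s → Fin p → F[X], IsPolynomialBasis V w → order v ≤ order w

/-- The minimal indices of `V` are the elements of `β` (with repetitions). -/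
def HasMinimalIndices {p : ℕ} (V : Submodule (RatFunc F) (Fin p → RatFunc F))
    (β : Multiset ℕ) : Prop :=
  ∃ (s : ℕ) (v : Fin s → Fin p → F[X]), IsMinimalBasis V v ∧
    β = Finset.univ.val.map fun i => vecDegree (v i)

/-- The kernel of `P` as a subspace of `F(x)^p`. -/
def ratKer {m p : ℕ} (P : Matrix (Fin m) (Fin p) F[X]) :
    Submodule (RatFunc F) (Fin p → RatFunc F) :=
  LinearMap.ker (P.map (algebraMap F[X] (RatFunc F))).mulVecLin

/-- The right minimal indices of `P` are the elements of `β`. -/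
def HasRightMinimalIndices {m p : ℕ} (P : Matrix (Fin m) (Fin p) F[X]) (β : Multiset ℕ) : Prop :=
  HasMinimalIndices (ratKer P) β

/-- The left minimal indices of `P` are the elements of `γ`. -/
def HasLeftMinimalIndices {m p : ℕ} (P : Matrix (Fin m) (Fin p) F[X]) (γ : Multiset ℕ) : Prop :=
  HasMinimalIndices (ratKer P.transpose) γ

/-! ### The rational transformation `x(y) = n(y) / d(y)` -/

/-- `G = max (deg n, deg d)`. -/
def ratDegree (n d : F[X]) : ℕ := max n.natDegree d.natDegree

/-- For `p = ∑ aᵢ xⁱ` of grade `g`, the polynomial `∑ aᵢ n(y)ⁱ d(y)^(g-i) = d(y)^g p(n(y)/d(y))`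
(see `algebraMap_transfPoly`). -/
def transfPoly (g : ℕ) (n d : F[X]) (p : F[X]) : F[X] :=
  ∑ i ∈ Finset.range (g + 1), C (p.coeff i) * n ^ i * d ^ (g - i)

/-- In `F(y)`, `transfPoly g n d p` is `d(y)^g p(n(y)/d(y))`. -/
theorem algebraMap_transfPoly (g : ℕ) (n d p : F[X]) (hd : d ≠ 0) (hp : p.natDegree ≤ g) :
    algebraMap F[X] (RatFunc F) (transfPoly g n d p) =
      algebraMap F[X] (RatFunc F) d ^ g *
        aeval (algebraMap F[X] (RatFunc F) n / algebraMap F[X] (RatFunc F) d) p := by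
  have hd' : algebraMap F[X] (RatFunc F) d ≠ 0 := by simpa using hd
  rw [aeval_eq_sum_range' (Nat.lt_succ_of_le hp), transfPoly, map_sum, Finset.mul_sum]
  refine Finset.sum_congr rfl fun i hi => ?_
  have hi' : i ≤ g := Nat.lt_succ_iff.mp (Finset.mem_range.mp hi)
  have h1 : algebraMap F[X] (RatFunc F) d ^ g =
      algebraMap F[X] (RatFunc F) d ^ (g - i) * algebraMap F[X] (RatFunc F) d ^ i := by
    rw [← pow_add, Nat.sub_add_cancel hi']
  have h2 : algebraMap F[X] (RatFunc F) (C (p.coeff i)) =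
      algebraMap F (RatFunc F) (p.coeff i) := by
    rw [IsScalarTower.algebraMap_apply F F[X] (RatFunc F)]; rfl
  rw [map_mul, map_mul, map_pow, map_pow, h1, h2, Algebra.smul_def, div_pow]
  field_simp

/-- `Q(y) = d(y)^g P(n(y)/d(y))`, entry by entry. -/
def transf {m p : ℕ} (g : ℕ) (n d : F[X]) (P : Matrix (Fin m) (Fin p) F[X]) :
    Matrix (Fin m) (Fin p) F[X] :=
  P.map (transfPoly g n d)

open Classical in
/-- The value `x(y₀) = n(y₀)/d(y₀)` in `F ∪ {∞}` at a point `y₀` of `F ∪ {∞}`, for coprime `n`, `d`.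
The value at `∞` is the quotient of the coefficients of `y^G`, `G = max (deg n, deg d)`. -/
def ratValue (n d : F[X]) : OnePoint F → OnePoint F
  | OnePoint.some a => if d.eval a = 0 then OnePoint.infty
      else OnePoint.some (n.eval a / d.eval a)
  | OnePoint.infty => if d.coeff (ratDegree n d) = 0 then OnePoint.infty
      else OnePoint.some (n.coeff (ratDegree n d) / d.coeff (ratDegree n d))

/-- The polynomial `α d(y) - β n(y)` with `α/β = x₀`: `(α, β) = (x₀, 1)` for finite `x₀`
and `(1, 0)` for `x₀ = ∞`. -/
def fiberPoly (n d : F[X]) : OnePoint F → F[X]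
  | OnePoint.some x₀ => C x₀ * d - n
  | OnePoint.infty => d

/-- `y₀` belongs to the counterimage `T_{x₀}` of `x₀` under `x(y)`. The point `∞` belongs to it when
`deg (α d - β n) < G`. -/
def MemFiber (n d : F[X]) (x₀ : OnePoint F) : OnePoint F → Prop
  | OnePoint.some a => ratValue n d (OnePoint.some a) = x₀
  | OnePoint.infty => (fiberPoly n d x₀).natDegree < ratDegree n d

/-- The multiplicity `m₀` of `y₀` as an element of `T_{x₀}`. -/
def fiberMultiplicity (n d : F[X]) (x₀ : OnePoint F) : OnePoint F → ℕ
  | OnePoint.some a => (fiberPoly n d x₀).rootMultiplicity a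
  | OnePoint.infty => ratDegree n d - (fiberPoly n d x₀).natDegree

end

end RatTransf

/-! Call d^k f(n/d) the transform of a polynomial f of grade k. It is multiplicative as long as
grades add (`transfPoly_mul`), so factorizations and linear relations over F[x] pass to transforms.

Elementary divisors. Let A P B = D be a Smith form, d(a) ≠ 0 and c = n(a)/d(a). The transforms of A
and B need not be unimodular, but their determinants at a are nonzero multiples of those of A and B
at c. So Q is equivalent, locally at a, to the diagonal matrix of the transformed invariant
polynomials (`LocalEquiv.transf`). This is enough, since the exponents at a can be read off from
dimensions that local equivalence preserves (`hasFiniteElementaryDivisors_iff`). A factor x - c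
becomes n - c d, which vanishes at a to order m₀, and a factor nonzero at c stays nonzero at a, so
exponents are multiplied by m₀ (`rootMultiplicity_transfPoly`). Poles reduce to this case by
swapping n and d and reversing P; y = ∞ reduces to y = 0 by reversing n and d, which reverses Q.

Minimal indices. The number of indices at most e is the dimension of the span of the kernel vectors
of degree at most e (`hasMinimalIndices_iff`). Every polynomial of degree less than G(k+1) is
uniquely a sum of y^j times transforms of polynomials of degree at most k, 0 ≤ j < G: coprimality
gives uniqueness and a dimension count gives existence. Hence the span for Q at e has the dimension
of the span for P at ⌊e/G⌋ (`finrank_polySpan_transf`), which multiplies all indices by G. -/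

open Polynomial

namespace RatTransf

noncomputable section

/-! ### Unimodular equivalence and the existence of the Smith form -/

section Unimodular

variable {R : Type*} [CommRing R] {m p : ℕ}

/-- `N = A M B` for some unimodular `A`, `B`. -/
def UnimodEquiv (M N : Matrix (Fin m) (Fin p) R) : Prop :=
  ∃ (A : Matrix (Fin m) (Fin m) R) (B : Matrix (Fin p) (Fin p) R),
    IsUnit A.det ∧ IsUnit B.det ∧ A * M * B = N

theorem UnimodEquiv.refl (M : Matrix (Fin m) (Fin p) R) : UnimodEquiv M M :=
  ⟨1, 1, by simp, by simp, by simp⟩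

theorem UnimodEquiv.trans {M N K : Matrix (Fin m) (Fin p) R} (h : UnimodEquiv M N)
    (h' : UnimodEquiv N K) : UnimodEquiv M K := by
  obtain ⟨A, B, hA, hB, rfl⟩ := h
  obtain ⟨A', B', hA', hB', rfl⟩ := h'
  exact ⟨A' * A, B * B', by rw [Matrix.det_mul]; exact hA'.mul hA,
    by rw [Matrix.det_mul]; exact hB.mul hB', by simp only [Matrix.mul_assoc]⟩

theorem UnimodEquiv.transpose {M N : Matrix (Fin m) (Fin p) R} (h : UnimodEquiv M N) :
    UnimodEquiv M.transpose N.transpose := by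
  obtain ⟨A, B, hA, hB, rfl⟩ := h
  exact ⟨B.transpose, A.transpose, by rwa [Matrix.det_transpose],
    by rwa [Matrix.det_transpose], by simp only [Matrix.transpose_mul, Matrix.mul_assoc]⟩

theorem UnimodEquiv.dvd {M N : Matrix (Fin m) (Fin p) R} (h : UnimodEquiv M N) {d : R}
    (hd : ∀ i j, d ∣ M i j) (i : Fin m) (j : Fin p) : d ∣ N i j := by
  obtain ⟨A, B, -, -, rfl⟩ := h
  rw [Matrix.mul_apply]
  refine Finset.dvd_sum fun k _ => Dvd.dvd.mul_right ?_ _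
  rw [Matrix.mul_apply]
  exact Finset.dvd_sum fun l _ => Dvd.dvd.mul_left (hd _ _) _

theorem UnimodEquiv.submatrix (M : Matrix (Fin m) (Fin p) R) (σ : Equiv.Perm (Fin m))
    (τ : Equiv.Perm (Fin p)) : UnimodEquiv M (M.submatrix σ τ) := by
  refine ⟨(1 : Matrix _ _ R).submatrix σ id, (1 : Matrix _ _ R).submatrix id τ, ?_, ?_, ?_⟩
  · rw [Matrix.det_permute, Matrix.det_one, mul_one]
    exact (Units.isUnit _).map (Int.castRingHom R)
  · rw [Matrix.det_permute', Matrix.det_one, mul_one]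
    exact (Units.isUnit _).map (Int.castRingHom R)
  · ext i j
    simp [Matrix.mul_apply, Matrix.one_apply]

/-- Adding multiples of a combination of rows to the rows. -/
theorem UnimodEquiv.add_rows (M : Matrix (Fin m) (Fin p) R) (u v : Fin m → R)
    (h : v ⬝ᵥ u = 0) : UnimodEquiv M (M + Matrix.vecMulVec u (Matrix.vecMul v M)) := by
  refine ⟨1 + Matrix.vecMulVec u v, 1, ?_, by simp, ?_⟩
  · rw [← Matrix.isUnit_iff_isUnit_det]
    -- Since v ⬝ u = 0, the rank-one term squares to zero.
    have : (1 + Matrix.vecMulVec u v) * (1 - Matrix.vecMulVec u v) = 1 := by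
      rw [add_mul, mul_sub, mul_sub, Matrix.vecMulVec_mul_vecMulVec, h]
      simp
    exact IsUnit.of_mul_eq_one _ this
  · rw [Matrix.mul_one, Matrix.add_mul, Matrix.one_mul, Matrix.vecMulVec_mul]

/-- The block diagonal matrix `diag(d, M)`. -/
def bordered (d : R) (M : Matrix (Fin m) (Fin p) R) : Matrix (Fin (m + 1)) (Fin (p + 1)) R :=
  Fin.cons (Fin.cons d 0) fun i => Fin.cons 0 (M i)

@[simp]
theorem bordered_zero_zero (d : R) (M : Matrix (Fin m) (Fin p) R) : bordered d M 0 0 = d := rfl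

@[simp]
theorem bordered_zero_succ (d : R) (M : Matrix (Fin m) (Fin p) R) (j : Fin p) :
    bordered d M 0 j.succ = 0 := rfl

@[simp]
theorem bordered_succ_zero (d : R) (M : Matrix (Fin m) (Fin p) R) (i : Fin m) :
    bordered d M i.succ 0 = 0 := rfl

@[simp]
theorem bordered_succ_succ (d : R) (M : Matrix (Fin m) (Fin p) R) (i : Fin m) (j : Fin p) :
    bordered d M i.succ j.succ = M i j := rfl

theorem bordered_mul {q : ℕ} (a b : R) (A : Matrix (Fin m) (Fin p) R)
    (B : Matrix (Fin p) (Fin q) R) : bordered a A * bordered b B = bordered (a * b) (A * B) := by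
  ext i j
  refine Fin.cases ?_ (fun i => ?_) i <;> refine Fin.cases ?_ (fun j => ?_) j <;>
    simp [Matrix.mul_apply, Fin.sum_univ_succ]

theorem det_bordered (a : R) (A : Matrix (Fin m) (Fin m) R) :
    (bordered a A).det = a * A.det := by
  rw [Matrix.det_succ_row_zero, Fin.sum_univ_succ]
  have : (bordered a A).submatrix Fin.succ (Fin.succAbove 0) = A := by
    ext i j; simp
  rw [this]
  simp

theorem UnimodEquiv.bordered {M N : Matrix (Fin m) (Fin p) R} (h : UnimodEquiv M N) (d u : R)
    (hu : IsUnit u) : UnimodEquiv (bordered d M) (bordered (u * d) N) := by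
  obtain ⟨A, B, hA, hB, rfl⟩ := h
  exact ⟨RatTransf.bordered u A, RatTransf.bordered 1 B, by rw [det_bordered]; exact hu.mul hA,
    by rw [det_bordered]; exact isUnit_one.mul hB, by rw [bordered_mul, bordered_mul, mul_one]⟩

end Unimodular

/-! ### Existence of the Smith form: reduction to a corner entry of least degree. -/

section Smith

variable {F : Type*} [Field F] {m p : ℕ}

/-- The corner entry has least degree among the nonzero entries of all equivalent matrices. -/
def CornerMinimal (N : Matrix (Fin (m + 1)) (Fin (p + 1)) F[X]) : Prop :=
  N 0 0 ≠ 0 ∧ ∀ N', UnimodEquiv N N' → ∀ i j, N' i j ≠ 0 → (N 0 0).natDegree ≤ (N' i j).natDegree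

theorem CornerMinimal.of_equiv {N N' : Matrix (Fin (m + 1)) (Fin (p + 1)) F[X]}
    (h : CornerMinimal N) (hN : UnimodEquiv N N') (h0 : N' 0 0 = N 0 0) : CornerMinimal N' := by
  refine ⟨h0 ▸ h.1, fun K hK i j hij => ?_⟩
  rw [h0]
  exact h.2 K (hN.trans hK) i j hij

theorem CornerMinimal.transpose {N : Matrix (Fin (m + 1)) (Fin (p + 1)) F[X]}
    (h : CornerMinimal N) : CornerMinimal N.transpose := by
  refine ⟨h.1, fun K hK i j hij => ?_⟩
  exact h.2 K.transpose (by simpa using hK.transpose) j i hij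

/-- Permutations bring any entry into the corner, so the least degree of a nonzero corner over all
equivalent matrices bounds all their nonzero entries. -/
theorem exists_cornerMinimal (M : Matrix (Fin (m + 1)) (Fin (p + 1)) F[X]) (hM : M ≠ 0) :
    ∃ N, UnimodEquiv M N ∧ CornerMinimal N := by
  classical
  have swap : ∀ (N : Matrix (Fin (m + 1)) (Fin (p + 1)) F[X]) i j,
      ∃ N', UnimodEquiv N N' ∧ N' 0 0 = N i j := fun N i j =>
    ⟨_, UnimodEquiv.submatrix N (Equiv.swap 0 i) (Equiv.swap 0 j), by simp⟩
  have hex : ∃ k, ∃ N, UnimodEquiv M N ∧ N 0 0 ≠ 0 ∧ (N 0 0).natDegree = k := by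
    obtain ⟨i, j, hij⟩ : ∃ i j, M i j ≠ 0 := by
      by_contra! h
      exact hM (by ext1 i j; exact h i j)
    obtain ⟨N, hN, h0⟩ := swap M i j
    exact ⟨_, N, hN, h0 ▸ hij, rfl⟩
  obtain ⟨N, hN, h0, hdeg⟩ := Nat.find_spec hex
  refine ⟨N, hN, h0, fun N' hN' i j hij => ?_⟩
  obtain ⟨K, hK, hK0⟩ := swap N' i j
  rw [hdeg, ← hK0]
  exact Nat.find_min' hex ⟨K, hN.trans (hN'.trans hK), hK0 ▸ hij, rfl⟩

/-- One row operation replaces the entry by its remainder modulo the corner; a nonzero remainder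
would contradict minimality. -/
theorem CornerMinimal.dvd_col {N : Matrix (Fin (m + 1)) (Fin (p + 1)) F[X]}
    (h : CornerMinimal N) (i : Fin (m + 1)) : N 0 0 ∣ N i 0 := by
  refine Fin.cases dvd_rfl (fun i => ?_) i
  have hE := UnimodEquiv.add_rows N (Pi.single i.succ (-(N i.succ 0 / N 0 0))) (Pi.single 0 1)
    (by simp)
  have hval : (N + Matrix.vecMulVec (Pi.single i.succ (-(N i.succ 0 / N 0 0)))
      (Matrix.vecMul (Pi.single 0 1) N)) i.succ 0 = N i.succ 0 % N 0 0 := by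
    rw [EuclideanDomain.mod_eq_sub_mul_div]
    simp [Matrix.vecMulVec_apply]
    ring
  by_contra hnd
  have hne : N i.succ 0 % N 0 0 ≠ 0 := fun h0 => hnd ((EuclideanDomain.mod_eq_zero).mp h0)
  have := h.2 _ hE i.succ 0 (by rwa [hval])
  rw [hval] at this
  have hlt := EuclideanDomain.mod_lt (N i.succ 0) h.1
  exact absurd (natDegree_lt_natDegree hne hlt) (by omega)

/-- That row 0 is unchanged matters twice: the corner stays minimal, and a second use on the
transpose clears the row without spoiling the cleared column. -/
theorem CornerMinimal.exists_clear_col {N : Matrix (Fin (m + 1)) (Fin (p + 1)) F[X]}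
    (h : CornerMinimal N) : ∃ N', UnimodEquiv N N' ∧ N' 0 = N 0 ∧ ∀ i : Fin m, N' i.succ 0 = 0 := by
  choose c hc using h.dvd_col
  refine ⟨_, UnimodEquiv.add_rows N (Fin.cons 0 fun i : Fin m => -c i.succ) (Pi.single 0 1)
    (by simp), ?_, fun i => ?_⟩
  · ext j : 1
    simp [Matrix.vecMulVec_apply]
  · simp only [Matrix.add_apply, Matrix.vecMulVec_apply, Fin.cons_succ, Matrix.single_one_vecMul,
      Matrix.row_apply]
    rw [hc i.succ]
    ring

theorem exists_bordered (M : Matrix (Fin (m + 1)) (Fin (p + 1)) F[X]) :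
    ∃ (d : F[X]) (M' : Matrix (Fin m) (Fin p) F[X]), UnimodEquiv M (bordered d M') ∧
      ∀ i j, d ∣ M' i j := by
  by_cases hM : M = 0
  · refine ⟨0, 0, ?_, fun _ _ => dvd_rfl⟩
    have : bordered (0 : F[X]) (0 : Matrix (Fin m) (Fin p) F[X]) = M := by
      rw [hM]
      ext1 i j
      refine Fin.cases ?_ (fun i => ?_) i <;> refine Fin.cases ?_ (fun j => ?_) j <;>
        simp
    rw [this]
    exact UnimodEquiv.refl M
  obtain ⟨N, hMN, hN⟩ := exists_cornerMinimal M hM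
  obtain ⟨N₁, hNN₁, hrow, hcol⟩ := hN.exists_clear_col
  have hN₁ : CornerMinimal N₁ := hN.of_equiv hNN₁ (by rw [hrow])
  obtain ⟨N₂, hN₁₂, hrow₂, hcol₂⟩ := hN₁.transpose.exists_clear_col
  have hE : UnimodEquiv N₁ N₂.transpose := by simpa using hN₁₂.transpose
  have hN₂ : CornerMinimal N₂.transpose := hN₁.of_equiv hE (by
    rw [Matrix.transpose_apply, hrow₂]; rfl)
  have hc : ∀ i : Fin m, N₂.transpose i.succ 0 = 0 := fun i => by
    rw [Matrix.transpose_apply, hrow₂]; exact hcol i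
  have hb : bordered (N₂ 0 0) (fun i j => N₂.transpose i.succ j.succ) = N₂.transpose := by
    ext1 i j
    refine Fin.cases ?_ (fun i => ?_) i <;> refine Fin.cases ?_ (fun j => ?_) j
    · rfl
    · exact (hcol₂ j).symm
    · exact (hc i).symm
    · rfl
  refine ⟨N₂ 0 0, fun i j => N₂.transpose i.succ j.succ, ?_, fun i j => ?_⟩
  · rw [hb]
    exact hMN.trans (hNN₁.trans hE)
  -- Adding row i + 1 to row 0, which is zero off the corner, keeps the corner and puts the block's
  -- row i beside it, so minimality yields the divisibility.
  · have hE' := UnimodEquiv.add_rows N₂.transpose (Pi.single 0 1) (Pi.single i.succ 1)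
      (by simp)
    have h00 : (N₂.transpose + Matrix.vecMulVec (Pi.single 0 1)
        (Matrix.vecMul (Pi.single i.succ 1) N₂.transpose) :
          Matrix (Fin (m + 1)) (Fin (p + 1)) F[X]) 0 0 = N₂.transpose 0 0 := by
      simpa [Matrix.vecMulVec_apply] using hc i
    have := (hN₂.of_equiv hE' h00).transpose.dvd_col j.succ
    rw [Matrix.transpose_apply, Matrix.transpose_apply, h00] at this
    have h2 := hcol₂ j
    simpa [Matrix.vecMulVec_apply, h2] using this

theorem rectDiag_apply_self {R : Type*} [Zero R] (δ : Fin (min m p) → R) (i : Fin (min m p)) :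
    rectDiag δ (i.castLE (min_le_left m p)) (i.castLE (min_le_right m p)) = δ i := by
  simp [rectDiag]

theorem exists_isUnit_mul_monic_or_zero (d : F[X]) :
    ∃ u : F[X], IsUnit u ∧ ((u * d).Monic ∨ u * d = 0) := by
  by_cases hd : d = 0
  · exact ⟨1, isUnit_one, Or.inr (by simp [hd])⟩
  · refine ⟨C d.leadingCoeff⁻¹, ?_, Or.inl ?_⟩
    · exact (isUnit_iff_ne_zero.mpr (inv_ne_zero (leadingCoeff_ne_zero.mpr hd))).map C
    · rw [mul_comm]; exact monic_mul_leadingCoeff_inv hd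

/-- Every polynomial matrix has a Smith form. -/
theorem exists_isInvariantPolynomials :
    ∀ {m p : ℕ} (P : Matrix (Fin m) (Fin p) F[X]), ∃ δ, IsInvariantPolynomials P δ
  | 0, p, P => by
    refine ⟨fun i => 0, fun i => Or.inr rfl, fun _ _ _ => dvd_rfl, 1, 1, by simp, by simp, ?_⟩
    ext1 i; exact i.elim0
  | m + 1, 0, P => by
    refine ⟨fun i => 0, fun i => Or.inr rfl, fun _ _ _ => dvd_rfl, 1, 1, by simp, by simp, ?_⟩
    ext1 i j; exact j.elim0
  | m + 1, p + 1, P => by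
    obtain ⟨d, M, hPM, hd⟩ := exists_bordered P
    obtain ⟨δ, hδm, hδd, hδ⟩ := exists_isInvariantPolynomials M
    obtain ⟨u, hu, hud⟩ := exists_isUnit_mul_monic_or_zero d
    -- A common divisor of all entries survives equivalence, so the corner extends the divisibility
    -- chain.
    have hdδ : ∀ i, u * d ∣ δ i := fun i => by
      rw [hu.mul_left_dvd]
      have := UnimodEquiv.dvd hδ hd (i.castLE (min_le_left m p)) (i.castLE (min_le_right m p))
      rwa [rectDiag_apply_self] at this
    have hmin : min (m + 1) (p + 1) = min m p + 1 := by omega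
    let δ' : Fin (min m p + 1) → F[X] := Fin.cons (u * d) δ
    refine ⟨fun i => δ' (i.cast hmin), fun i => ?_, fun i j hij => ?_, ?_⟩
    · show (δ' (i.cast hmin)).Monic ∨ δ' (i.cast hmin) = 0
      generalize i.cast hmin = i'
      induction i' using Fin.cases with
      | zero => exact hud
      | succ i' => exact hδm i'
    · have hij' : i.cast hmin ≤ j.cast hmin := hij
      show δ' (i.cast hmin) ∣ δ' (j.cast hmin)
      generalize i.cast hmin = i' at *
      generalize j.cast hmin = j' at *
      induction i' using Fin.cases with
      | zero =>
        induction j' using Fin.cases with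
        | zero => exact dvd_rfl
        | succ j' => exact hdδ j'
      | succ i' =>
        induction j' using Fin.cases with
        | zero => simp at hij'
        | succ j' => exact hδd i' j' (Fin.succ_le_succ_iff.mp hij')
    · refine hPM.trans ?_
      have : rectDiag (fun i : Fin (min (m + 1) (p + 1)) => δ' (i.cast hmin)) =
          bordered (u * d) (rectDiag δ) := by
        ext1 i j
        refine Fin.cases ?_ (fun i => ?_) i <;> refine Fin.cases ?_ (fun j => ?_) j
        · simp [rectDiag]; rfl
        · simp [rectDiag]
        · simp [rectDiag]
        · simp only [rectDiag, bordered_succ_succ, Fin.val_succ, add_left_inj]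
          split_ifs <;> rfl
      rw [this]
      exact UnimodEquiv.bordered hδ d u hu

end Smith

/-! ### Local equivalence and uniqueness of the elementary divisors -/

section Local

variable {F : Type*} [Field F] {m p : ℕ}

/-- The values at `a` of the polynomial vectors `v` such that `(X - a)^e` divides `M v`. -/
def localRange (M : Matrix (Fin m) (Fin p) F[X]) (a : F) (e : ℕ) : Submodule F (Fin p → F) where
  carrier := {w | ∃ v : Fin p → F[X], (∀ i, (X - C a) ^ e ∣ M.mulVec v i) ∧
    ∀ j, (v j).eval a = w j}
  add_mem' := by
    rintro w w' ⟨v, hv, hw⟩ ⟨v', hv', hw'⟩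
    refine ⟨v + v', fun i => ?_, fun j => by simp [hw, hw']⟩
    rw [Matrix.mulVec_add]
    exact dvd_add (hv i) (hv' i)
  zero_mem' := ⟨0, by simp, by simp⟩
  smul_mem' := by
    rintro c w ⟨v, hv, hw⟩
    refine ⟨C c • v, fun i => ?_, fun j => by simp [hw]⟩
    rw [Matrix.mulVec_smul]
    exact Dvd.dvd.mul_left (hv i) _

theorem dvd_of_dvd_mul_of_eval_ne_zero {a : F} {e : ℕ} {f h : F[X]} (hf : f.eval a ≠ 0)
    (hd : (X - C a) ^ e ∣ f * h) : (X - C a) ^ e ∣ h := by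
  refine IsCoprime.dvd_of_dvd_mul_left (IsCoprime.pow_left ?_) hd
  rw [(irreducible_X_sub_C a).coprime_iff_not_dvd, dvd_iff_isRoot]
  exact hf

theorem eval_mulVec (B : Matrix (Fin m) (Fin p) F[X]) (a : F) (v : Fin p → F[X]) (i : Fin m) :
    (B.mulVec v i).eval a = (B.map (eval a)).mulVec (fun j => (v j).eval a) i := by
  simp [Matrix.mulVec, dotProduct, eval_finsetSum]

theorem eval_det (B : Matrix (Fin m) (Fin m) F[X]) (a : F) :
    B.det.eval a = (B.map (eval a)).det := by
  rw [← coe_evalRingHom, RingHom.map_det]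
  rfl

theorem mulVec_injective_of_eval_det_ne_zero {B : Matrix (Fin p) (Fin p) F[X]} {a : F}
    (hB : B.det.eval a ≠ 0) : Function.Injective (B.map (eval a)).mulVecLin := by
  rw [eval_det] at hB
  intro v w h
  exact Matrix.mulVec_injective_of_isUnit
    ((Matrix.isUnit_iff_isUnit_det _).mpr (isUnit_iff_ne_zero.mpr hB)) h

theorem finrank_le_of_injective {U V : Submodule F (Fin p → F)}
    (f : (Fin p → F) →ₗ[F] (Fin p → F)) (hf : Function.Injective f) (h : ∀ w ∈ U, f w ∈ V) :
    Module.finrank F U ≤ Module.finrank F V := by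
  rw [(Submodule.equivMapOfInjective f hf U).finrank_eq]
  exact Submodule.finrank_mono (Submodule.map_le_iff_le_comap.mpr h)

theorem eval_det_adjugate_ne_zero {B : Matrix (Fin p) (Fin p) F[X]} {a : F}
    (hB : B.det.eval a ≠ 0) : B.adjugate.det.eval a ≠ 0 := by
  rw [Matrix.det_adjugate, eval_pow]
  exact pow_ne_zero _ hB

/-- `N = A M B` with `A` and `B` invertible at `a`. -/
def LocalEquiv (a : F) (M N : Matrix (Fin m) (Fin p) F[X]) : Prop :=
  ∃ (A : Matrix (Fin m) (Fin m) F[X]) (B : Matrix (Fin p) (Fin p) F[X]),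
    A.det.eval a ≠ 0 ∧ B.det.eval a ≠ 0 ∧ A * M * B = N

theorem UnimodEquiv.localEquiv {M N : Matrix (Fin m) (Fin p) F[X]} (h : UnimodEquiv M N) (a : F) :
    LocalEquiv a M N := by
  obtain ⟨A, B, hA, hB, h⟩ := h
  exact ⟨A, B, (hA.map (evalRingHom a)).ne_zero, (hB.map (evalRingHom a)).ne_zero, h⟩

/-- Adjugates replace the missing inverses: v ↦ adj(B) v and v ↦ B v map each range into the other,
injectively at a. Going back, adj(A) turns A M B v into det A · M B v, and det A is prime to X - a.
-/
theorem LocalEquiv.finrank_eq {a : F} {M N : Matrix (Fin m) (Fin p) F[X]} (h : LocalEquiv a M N)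
    (e : ℕ) : Module.finrank F (localRange M a e) = Module.finrank F (localRange N a e) := by
  obtain ⟨A, B, hA, hB, rfl⟩ := h
  apply le_antisymm
  · refine finrank_le_of_injective _
      (mulVec_injective_of_eval_det_ne_zero (eval_det_adjugate_ne_zero hB)) ?_
    rintro w ⟨v, hv, hw⟩
    refine ⟨B.adjugate.mulVec v, fun i => ?_, fun j => ?_⟩
    · have : (A * M * B).mulVec (B.adjugate.mulVec v) = A.mulVec (B.det • M.mulVec v) := by
        rw [Matrix.mulVec_mulVec, Matrix.mul_assoc, Matrix.mul_adjugate, Matrix.mul_smul,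
          Matrix.mul_one, Matrix.smul_mulVec, ← Matrix.mulVec_mulVec, Matrix.mulVec_smul]
      rw [this, Matrix.mulVec, dotProduct]
      exact Finset.dvd_sum fun k _ => Dvd.dvd.mul_left (Dvd.dvd.mul_left (hv k) _) _
    · rw [eval_mulVec]
      simp [hw]
  · refine finrank_le_of_injective _ (mulVec_injective_of_eval_det_ne_zero hB) ?_
    rintro w ⟨v, hv, hw⟩
    refine ⟨B.mulVec v, fun i => ?_, fun j => ?_⟩
    · have : A.adjugate.mulVec ((A * M * B).mulVec v) = A.det • M.mulVec (B.mulVec v) := by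
        rw [Matrix.mulVec_mulVec, Matrix.mul_assoc A, ← Matrix.mul_assoc, Matrix.adjugate_mul,
          Matrix.smul_mul, Matrix.one_mul, Matrix.smul_mulVec, Matrix.mulVec_mulVec]
      refine dvd_of_dvd_mul_of_eval_ne_zero hA ?_
      have h2 : A.det * M.mulVec (B.mulVec v) i = A.adjugate.mulVec ((A * M * B).mulVec v) i := by
        rw [this]; rfl
      rw [h2, Matrix.mulVec, dotProduct]
      exact Finset.dvd_sum fun k _ => Dvd.dvd.mul_left (hv k) _
    · rw [eval_mulVec]
      simp [hw]

theorem rectDiag_mulVec (δ : Fin (min m p) → F[X]) (v : Fin p → F[X]) (i : Fin m) :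
    (rectDiag δ).mulVec v i = if h : (i : ℕ) < min m p then
      δ ⟨i, h⟩ * v ⟨i, h.trans_le (min_le_right m p)⟩ else 0 := by
  rw [Matrix.mulVec, dotProduct]
  split_ifs with h
  · rw [Finset.sum_eq_single ⟨i, h.trans_le (min_le_right m p)⟩]
    · simp [rectDiag]
    · intro j _ hj
      have : (i : ℕ) ≠ j := fun h' => hj (Fin.ext h'.symm)
      simp [rectDiag, this]
    · simp
  · refine Finset.sum_eq_zero fun j _ => ?_
    have : (i : ℕ) ≠ j := by have := i.2; have := j.2; omega
    simp [rectDiag, this]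

/-- The conditions separate by coordinates: where `(X - C a) ^ e` does not divide δ i the coordinate
must vanish at a; elsewhere a constant will do. -/
theorem mem_localRange_rectDiag (δ : Fin (min m p) → F[X]) (a : F) (e : ℕ) (w : Fin p → F) :
    w ∈ localRange (rectDiag δ) a e ↔
      ∀ i, ¬ (X - C a) ^ e ∣ δ i → w (i.castLE (min_le_right m p)) = 0 := by
  classical
  constructor
  · rintro ⟨v, hv, hw⟩ i hi
    rw [← hw]
    by_contra hne
    refine hi (dvd_of_dvd_mul_of_eval_ne_zero hne ?_)
    have := hv (i.castLE (min_le_left m p))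
    rw [rectDiag_mulVec,
      dif_pos (show ((i.castLE (min_le_left m p) : Fin m) : ℕ) < min m p from i.2)] at this
    rw [mul_comm]
    exact this
  · intro h
    refine ⟨fun j => C (w j), fun i => ?_, fun j => by simp⟩
    rw [rectDiag_mulVec]
    split_ifs with hi
    · by_cases hd : (X - C a) ^ e ∣ δ ⟨i, hi⟩
      · exact Dvd.dvd.mul_right hd _
      · have := h ⟨i, hi⟩ hd
        have h2 : w ⟨i, hi.trans_le (min_le_right m p)⟩ = 0 := this
        simp [h2]
    · exact dvd_zero _

open Classical in
-- Rank-nullity for the restriction of w to the coordinates where divisibility fails.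
theorem card_add_finrank_localRange (δ : Fin (min m p) → F[X]) (a : F) (e : ℕ) :
    (Finset.univ.filter fun i => ¬ (X - C a) ^ e ∣ δ i).card +
      Module.finrank F (localRange (rectDiag δ) a e) = p := by
  let s : Type := {i // ¬ (X - C a) ^ e ∣ δ i}
  let f : s → Fin p := fun i => i.1.castLE (min_le_right m p)
  have hf : Function.Injective f := fun i j h => Subtype.ext (Fin.castLE_injective _ h)
  have hker : localRange (rectDiag δ) a e = LinearMap.ker (LinearMap.funLeft F F f) := by
    ext w
    rw [mem_localRange_rectDiag, LinearMap.mem_ker]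
    exact ⟨fun h => funext fun i => h i.1 i.2, fun h i hi => congrFun h ⟨i, hi⟩⟩
  have := LinearMap.finrank_range_add_finrank_ker (LinearMap.funLeft F F f)
  rw [LinearMap.range_eq_top.mpr (LinearMap.funLeft_surjective_of_injective F F f hf), finrank_top,
    ← hker, Module.finrank_fintype_fun_eq_card, Module.finrank_fintype_fun_eq_card,
    Fintype.card_fin, Fintype.card_subtype] at this
  exact this

/-- The positive multiplicities of `a` as a root of the diagonal entries `δ`. -/
def localDivisors {ν : ℕ} (δ : Fin ν → F[X]) (a : F) : Multiset ℕ :=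
  (Finset.univ.val.map fun i => (δ i).rootMultiplicity a).filter fun ℓ => 0 < ℓ

open Classical in
-- With the dimension formula above, this recovers the multiplicity of every exponent from
-- dimensions.
theorem count_localDivisors {ν : ℕ} (δ : Fin ν → F[X]) (a : F) (e : ℕ) (he : 0 < e) :
    (localDivisors δ a).count e + (Finset.univ.filter fun i => ¬ (X - C a) ^ e ∣ δ i).card =
      (Finset.univ.filter fun i => ¬ (X - C a) ^ (e + 1) ∣ δ i).card := by
  have h1 : (localDivisors δ a).count e =
      (Finset.univ.filter fun i => (δ i).rootMultiplicity a = e).card := by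
    rw [localDivisors, Multiset.count_filter_of_pos he, Multiset.count_map, Finset.card_def,
      Finset.filter_val]
    simp only [eq_comm]
  have hiff : ∀ i, (δ i).rootMultiplicity a = e ↔
      (X - C a) ^ e ∣ δ i ∧ ¬ (X - C a) ^ (e + 1) ∣ δ i := by
    intro i
    by_cases h0 : δ i = 0
    -- A zero entry has `rootMultiplicity` 0 ≠ e and is divisible by every power, so both sides are
    -- false.
    · simp [h0, he.ne]
    · rw [← le_rootMultiplicity_iff h0, ← le_rootMultiplicity_iff h0]
      omega
  rw [h1, ← Finset.card_union_of_disjoint]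
  · congr 1
    ext i
    simp only [Finset.mem_union, Finset.mem_filter, Finset.mem_univ, true_and, hiff]
    constructor
    · rintro (h | h)
      · exact h.2
      · exact fun h' => h ((pow_dvd_pow _ e.le_succ).trans h')
    · intro h
      by_cases h' : (X - C a) ^ e ∣ δ i
      · exact Or.inl ⟨h', h⟩
      · exact Or.inr h'
  · rw [Finset.disjoint_filter]
    intro i _ h h'
    exact h' ((hiff i).mp h).1

theorem localDivisors_eq_of_localEquiv {a : F} {M : Matrix (Fin m) (Fin p) F[X]}
    {δ δ' : Fin (min m p) → F[X]} (h : LocalEquiv a M (rectDiag δ))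
    (h' : LocalEquiv a M (rectDiag δ')) : localDivisors δ a = localDivisors δ' a := by
  classical
  have hcard : ∀ e, (Finset.univ.filter fun i => ¬ (X - C a) ^ e ∣ δ i).card =
      (Finset.univ.filter fun i => ¬ (X - C a) ^ e ∣ δ' i).card := fun e => by
    have h1 := card_add_finrank_localRange δ a e
    have h2 := card_add_finrank_localRange δ' a e
    rw [← h.finrank_eq e] at h1
    rw [← h'.finrank_eq e] at h2
    omega
  ext e
  rcases Nat.eq_zero_or_pos e with rfl | he
  · simp [localDivisors]
  · have h1 := count_localDivisors δ a e he
    have h2 := count_localDivisors δ' a e he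
    rw [hcard, hcard] at h1
    omega

/-- Any local diagonalization will do: its entries need be neither monic nor a divisibility chain,
as is the case for transformed invariant polynomials. -/
theorem hasFiniteElementaryDivisors_iff {a : F} {M : Matrix (Fin m) (Fin p) F[X]}
    {δ : Fin (min m p) → F[X]} (h : LocalEquiv a M (rectDiag δ)) (L : Multiset ℕ) :
    HasFiniteElementaryDivisors M a L ↔ L = localDivisors δ a := by
  constructor
  · rintro ⟨δ', ⟨-, -, hδ'⟩, rfl⟩
    exact localDivisors_eq_of_localEquiv (UnimodEquiv.localEquiv hδ' a) h
  · rintro rfl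
    obtain ⟨δ', hδ'⟩ := exists_isInvariantPolynomials M
    exact ⟨δ', hδ', localDivisors_eq_of_localEquiv h (UnimodEquiv.localEquiv hδ'.2.2 a)⟩

end Local

/-! ### The transformation of polynomials and matrices -/

section Transf

variable {F : Type*} [Field F]

theorem transfPoly_zero (g : ℕ) (n d : F[X]) : transfPoly g n d 0 = 0 := by
  simp [transfPoly]

theorem transfPoly_add (g : ℕ) (n d f h : F[X]) :
    transfPoly g n d (f + h) = transfPoly g n d f + transfPoly g n d h := by
  simp [transfPoly, add_mul, Finset.sum_add_distrib]

theorem transfPoly_sum {ι : Type*} (s : Finset ι) (g : ℕ) (n d : F[X]) (f : ι → F[X]) :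
    transfPoly g n d (∑ i ∈ s, f i) = ∑ i ∈ s, transfPoly g n d (f i) :=
  map_sum (AddMonoidHom.mk' (transfPoly g n d) (transfPoly_add g n d)) f s

/-- In F(y) substitution of n/d is a ring homomorphism; the powers of d match because the grades
add. -/
theorem transfPoly_mul {a b : ℕ} {n d f h : F[X]} (hd : d ≠ 0) (hf : f.natDegree ≤ a)
    (hh : h.natDegree ≤ b) :
    transfPoly (a + b) n d (f * h) = transfPoly a n d f * transfPoly b n d h := by
  apply IsFractionRing.injective F[X] (RatFunc F)
  rw [map_mul, algebraMap_transfPoly _ _ _ _ hd hf, algebraMap_transfPoly _ _ _ _ hd hh,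
    algebraMap_transfPoly _ _ _ _ hd (natDegree_mul_le_of_le hf hh), map_mul, pow_add]
  ring

theorem eval_transfPoly {g : ℕ} {n d f : F[X]} {a : F} (ha : d.eval a ≠ 0)
    (hf : f.natDegree ≤ g) :
    (transfPoly g n d f).eval a = d.eval a ^ g * f.eval (n.eval a / d.eval a) := by
  rw [transfPoly, eval_finsetSum, eval_eq_sum_range' (Nat.lt_succ_of_le hf), Finset.mul_sum]
  refine Finset.sum_congr rfl fun i hi => ?_
  have hi' : i ≤ g := Nat.lt_succ_iff.mp (Finset.mem_range.mp hi)
  obtain ⟨k, rfl⟩ := Nat.exists_eq_add_of_le hi'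
  simp only [eval_mul, eval_C, eval_pow, add_tsub_cancel_left, pow_add, div_pow]
  field_simp

theorem natDegree_transfPoly_le (g : ℕ) (n d f : F[X]) :
    (transfPoly g n d f).natDegree ≤ g * ratDegree n d := by
  refine natDegree_sum_le_of_forall_le _ _ fun i hi => ?_
  have hi' : i ≤ g := Nat.lt_succ_iff.mp (Finset.mem_range.mp hi)
  obtain ⟨k, rfl⟩ := Nat.exists_eq_add_of_le hi'
  rw [add_tsub_cancel_left, add_mul]
  refine natDegree_mul_le_of_le ((natDegree_C_mul_le _ _).trans ?_) ?_
  · exact natDegree_pow_le_of_le i (le_max_left _ _)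
  · exact natDegree_pow_le_of_le k (le_max_right _ _)

/-- The substitution x ↦ 1/x, by which poles of n/d become zeros of d/n. -/
theorem transfPoly_swap (g : ℕ) (n d f : F[X]) :
    transfPoly g d n (reflect g f) = transfPoly g n d f := by
  rw [transfPoly, transfPoly, ← Finset.sum_range_reflect]
  refine Finset.sum_congr rfl fun i hi => ?_
  have hi' : i ≤ g := Nat.lt_succ_iff.mp (Finset.mem_range.mp hi)
  have h1 : g + 1 - 1 - i = g - i := by omega
  rw [h1, coeff_reflect, revAt_le (Nat.sub_le g i), Nat.sub_sub_self hi']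
  ring

theorem reflect_pow {N : ℕ} {f : F[X]} (hf : f.natDegree ≤ N) (k : ℕ) :
    reflect (k * N) (f ^ k) = reflect N f ^ k := by
  induction k with
  | zero => simp
  | succ k ih =>
    rw [pow_succ, pow_succ, add_mul, one_mul, reflect_mul _ _ (natDegree_pow_le_of_le k hf) hf, ih]

theorem reflect_sum {ι : Type*} (s : Finset ι) (N : ℕ) (f : ι → F[X]) :
    reflect N (∑ i ∈ s, f i) = ∑ i ∈ s, reflect N (f i) :=
  map_sum (AddMonoidHom.mk' (reflect N) fun f h => reflect_add f h N) f s

/-- The substitution y ↦ 1/y, by which y = ∞ becomes y = 0. -/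
theorem reflect_transfPoly {n d : F[X]} {G : ℕ} (hn : n.natDegree ≤ G) (hd : d.natDegree ≤ G)
    (g : ℕ) (f : F[X]) :
    reflect (g * G) (transfPoly g n d f) = transfPoly g (reflect G n) (reflect G d) f := by
  rw [transfPoly, transfPoly, reflect_sum]
  refine Finset.sum_congr rfl fun i hi => ?_
  have hi' : i ≤ g := Nat.lt_succ_iff.mp (Finset.mem_range.mp hi)
  obtain ⟨k, rfl⟩ := Nat.exists_eq_add_of_le hi'
  rw [add_tsub_cancel_left, mul_assoc, reflect_C_mul, add_mul,
    reflect_mul _ _ (natDegree_pow_le_of_le i hn) (natDegree_pow_le_of_le k hd),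
    reflect_pow hn, reflect_pow hd, mul_assoc]

theorem transf_mul {m p q a b : ℕ} {n d : F[X]} (hd : d ≠ 0) {A : Matrix (Fin m) (Fin p) F[X]}
    {B : Matrix (Fin p) (Fin q) F[X]} (hA : HasGrade A a) (hB : HasGrade B b) :
    transf (a + b) n d (A * B) = transf a n d A * transf b n d B := by
  ext1 i j
  simp only [transf, Matrix.map_apply, Matrix.mul_apply, transfPoly_sum]
  exact Finset.sum_congr rfl fun k _ => transfPoly_mul hd (hA i k) (hB k j)

theorem HasGrade.mul {m p q a b : ℕ} {A : Matrix (Fin m) (Fin p) F[X]}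
    {B : Matrix (Fin p) (Fin q) F[X]} (hA : HasGrade A a) (hB : HasGrade B b) :
    HasGrade (A * B) (a + b) := fun i j => by
  rw [Matrix.mul_apply]
  exact natDegree_sum_le_of_forall_le _ _ fun k _ => natDegree_mul_le_of_le (hA i k) (hB k j)

theorem HasGrade.mono {m p a b : ℕ} {A : Matrix (Fin m) (Fin p) F[X]} (hA : HasGrade A a)
    (h : a ≤ b) : HasGrade A b := fun i j => (hA i j).trans h

theorem exists_hasGrade {m p : ℕ} (A : Matrix (Fin m) (Fin p) F[X]) : ∃ a, HasGrade A a :=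
  ⟨Finset.univ.sup fun ij : Fin m × Fin p => (A ij.1 ij.2).natDegree, fun i j =>
    Finset.le_sup (f := fun ij : Fin m × Fin p => (A ij.1 ij.2).natDegree) (Finset.mem_univ (i, j))⟩

theorem transf_rectDiag {m p : ℕ} (g : ℕ) (n d : F[X]) (δ : Fin (min m p) → F[X]) :
    transf g n d (rectDiag δ) = rectDiag (m := m) (p := p) fun i => transfPoly g n d (δ i) := by
  ext1 i j
  simp only [transf, Matrix.map_apply, rectDiag]
  split_ifs
  · rfl
  · exact transfPoly_zero g n d

theorem eval_det_transf {m g : ℕ} {n d : F[X]} {a : F} (ha : d.eval a ≠ 0)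
    {A : Matrix (Fin m) (Fin m) F[X]} (hA : HasGrade A g) :
    (transf g n d A).det.eval a = (d.eval a ^ g) ^ m * A.det.eval (n.eval a / d.eval a) := by
  rw [eval_det, eval_det]
  have : (transf g n d A).map (eval a) =
      (d.eval a ^ g) • A.map (eval (n.eval a / d.eval a)) := by
    ext1 i j
    exact eval_transfPoly ha (hA i j)
  rw [this, Matrix.det_smul, Fintype.card_fin]

/-- The diagonal form is transformed with k = the sum of the grades of A, P and B, so that the
transform respects the product A P B. -/
theorem LocalEquiv.transf {m p g : ℕ} {n d : F[X]} {a : F} (ha : d.eval a ≠ 0)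
    {P : Matrix (Fin m) (Fin p) F[X]} (hP : HasGrade P g) {δ : Fin (min m p) → F[X]}
    (h : LocalEquiv (n.eval a / d.eval a) P (rectDiag δ)) :
    ∃ k, (∀ i, (δ i).natDegree ≤ k) ∧ LocalEquiv a (RatTransf.transf g n d P)
      (rectDiag fun i => transfPoly k n d (δ i)) := by
  have hd : d ≠ 0 := by rintro rfl; simp at ha
  obtain ⟨A, B, hA, hB, hE⟩ := h
  obtain ⟨a', hA'⟩ := exists_hasGrade A
  obtain ⟨b', hB'⟩ := exists_hasGrade B
  refine ⟨a' + g + b', fun i => ?_, RatTransf.transf a' n d A, RatTransf.transf b' n d B, ?_, ?_, ?_⟩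
  · have := ((hA'.mul hP).mul hB') (i.castLE (min_le_left m p)) (i.castLE (min_le_right m p))
    rwa [hE, rectDiag_apply_self] at this
  · rw [eval_det_transf ha hA']
    exact mul_ne_zero (pow_ne_zero _ (pow_ne_zero _ ha)) hA
  · rw [eval_det_transf ha hB']
    exact mul_ne_zero (pow_ne_zero _ (pow_ne_zero _ ha)) hB
  · rw [← transf_mul hd hA' hP, ← transf_mul hd (hA'.mul hP) hB', hE, transf_rectDiag]

/-! ### Root multiplicities of transforms. -/

theorem transfPoly_pow {a : ℕ} {n d f : F[X]} (hd : d ≠ 0) (hf : f.natDegree ≤ a) (k : ℕ) :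
    transfPoly (k * a) n d (f ^ k) = transfPoly a n d f ^ k := by
  induction k with
  | zero => simp [transfPoly]
  | succ k ih =>
    rw [pow_succ, pow_succ, add_mul, one_mul, transfPoly_mul hd (natDegree_pow_le_of_le k hf) hf, ih]

theorem transfPoly_X_sub_C (n d : F[X]) (c : F) : transfPoly 1 n d (X - C c) = n - C c * d := by
  simp [transfPoly, Finset.sum_range_succ]
  ring

theorem rootMultiplicity_transfPoly {k : ℕ} {n d f : F[X]} {a : F} (ha : d.eval a ≠ 0)
    (hne : n - C (n.eval a / d.eval a) * d ≠ 0) (hf : f.natDegree ≤ k) :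
    (transfPoly k n d f).rootMultiplicity a =
      (n - C (n.eval a / d.eval a) * d).rootMultiplicity a *
        f.rootMultiplicity (n.eval a / d.eval a) := by
  classical
  have hd : d ≠ 0 := by rintro rfl; simp at ha
  by_cases h0 : f = 0
  · simp [h0, transfPoly_zero]
  set c := n.eval a / d.eval a with hc
  obtain ⟨u, hu, hu'⟩ := exists_eq_pow_rootMultiplicity_mul_and_not_dvd f h0 c
  set l := f.rootMultiplicity c
  have hu0 : u ≠ 0 := by rintro rfl; simp at hu'
  have hdeg : f.natDegree = l + u.natDegree := by
    conv_lhs => rw [hu]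
    rw [natDegree_mul (pow_ne_zero _ (X_sub_C_ne_zero c)) hu0, natDegree_pow, natDegree_X_sub_C,
      mul_one]
  -- The grade is split into l factors x - c of grade 1 and a cofactor of grade k'. Excess grade
  -- only adds powers of d, nonzero at a.
  obtain ⟨k', rfl⟩ : ∃ k', k = l * 1 + k' := ⟨k - l, by omega⟩
  have huk : u.natDegree ≤ k' := by omega
  have hev : (transfPoly k' n d u).eval a ≠ 0 := by
    rw [eval_transfPoly ha huk]
    refine mul_ne_zero (pow_ne_zero _ ha) fun h => hu' (dvd_iff_isRoot.mpr h)
  have hu1 : transfPoly k' n d u ≠ 0 := by rintro h; simp [h] at hev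
  conv_lhs => rw [hu]
  rw [transfPoly_mul hd (natDegree_pow_le_of_le l (natDegree_X_sub_C_le c)) huk,
    transfPoly_pow hd (natDegree_X_sub_C_le c), transfPoly_X_sub_C,
    rootMultiplicity_mul (mul_ne_zero (pow_ne_zero _ hne) hu1),
    rootMultiplicity_eq_zero (p := transfPoly k' n d u) hev, add_zero, ← count_roots, roots_pow,
    Multiset.count_nsmul, count_roots, mul_comm]

/-- `P` has exactly one system of elementary divisors at `n(a)/d(a)`, and its transform has exactly
one at `a`, which is obtained by scaling the exponents by the multiplicity of `a`. -/
theorem exists_elementaryDivisors_transf {m p g : ℕ} {n d : F[X]} {a : F} (ha : d.eval a ≠ 0)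
    (hne : n - C (n.eval a / d.eval a) * d ≠ 0)
    {P : Matrix (Fin m) (Fin p) F[X]} (hP : HasGrade P g) :
    ∃ L₀ : Multiset ℕ,
      (∀ L, HasFiniteElementaryDivisors P (n.eval a / d.eval a) L ↔ L = L₀) ∧
      ∀ L, HasFiniteElementaryDivisors (transf g n d P) a L ↔
        L = L₀.map fun l => (n - C (n.eval a / d.eval a) * d).rootMultiplicity a * l := by
  obtain ⟨δ, hδ⟩ := exists_isInvariantPolynomials P
  have hloc := UnimodEquiv.localEquiv hδ.2.2 (n.eval a / d.eval a)
  obtain ⟨k, hk, hloc'⟩ := hloc.transf ha hP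
  refine ⟨_, hasFiniteElementaryDivisors_iff hloc, fun L => ?_⟩
  rw [hasFiniteElementaryDivisors_iff hloc']
  -- Positivity makes scaling commute with the filter that keeps positive exponents.
  have hpos : 0 < (n - C (n.eval a / d.eval a) * d).rootMultiplicity a := by
    rw [rootMultiplicity_pos hne, IsRoot.def, eval_sub, eval_mul, eval_C, div_mul_cancel₀ _ ha,
      sub_self]
  have : localDivisors (fun i => transfPoly k n d (δ i)) a =
      (localDivisors δ (n.eval a / d.eval a)).map
        fun l => (n - C (n.eval a / d.eval a) * d).rootMultiplicity a * l := by
    rw [localDivisors, localDivisors, Multiset.filter_map, Multiset.filter_map, Multiset.map_map]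
    simp only [Function.comp_def, rootMultiplicity_transfPoly ha hne (hk _),
      mul_pos_iff_of_pos_left hpos]
  rw [this]

end Transf

/-! ### Elementary divisors at the points of the projective line -/

section Points

variable {F : Type*} [Field F]

theorem rootMultiplicity_neg (f : F[X]) (a : F) :
    (-f).rootMultiplicity a = f.rootMultiplicity a := by
  classical
  rw [← count_roots, roots_neg, count_roots]

theorem ratValue_some_of_ne_zero {n d : F[X]} {a : F} (ha : d.eval a ≠ 0) :
    ratValue n d (OnePoint.some a) = OnePoint.some (n.eval a / d.eval a) := if_neg ha

theorem ratValue_some_of_eq_zero {n d : F[X]} {a : F} (ha : d.eval a = 0) :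
    ratValue n d (OnePoint.some a) = OnePoint.infty := if_pos ha

theorem transf_swap {m p : ℕ} (g : ℕ) (n d : F[X]) (P : Matrix (Fin m) (Fin p) F[X]) :
    transf g d n (rev g P) = transf g n d P := by
  ext1 i j
  exact transfPoly_swap g n d (P i j)

theorem HasGrade.rev {m p g : ℕ} {P : Matrix (Fin m) (Fin p) F[X]} (hP : HasGrade P g) :
    HasGrade (rev g P) g := fun i j => by
  have h := natDegree_reflect_le (N := g) (p := P i j)
  rwa [max_eq_left (hP i j)] at h

/-- At a pole, n and d are swapped and P is reversed, so that the value becomes 0; at other points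
only the sign of the fibre polynomial differs. -/
theorem exists_elementaryDivisors_transf_at {m p g : ℕ} {n d : F[X]} {a : F}
    (hnd : d.eval a = 0 → n.eval a ≠ 0)
    (hne : fiberPoly n d (ratValue n d (OnePoint.some a)) ≠ 0)
    {P : Matrix (Fin m) (Fin p) F[X]} (hP : HasGrade P g) :
    ∃ L₀ : Multiset ℕ,
      (∀ L, HasElementaryDivisors P g (ratValue n d (OnePoint.some a)) L ↔ L = L₀) ∧
      ∀ L, HasFiniteElementaryDivisors (transf g n d P) a L ↔ L = L₀.map fun l =>
        (fiberPoly n d (ratValue n d (OnePoint.some a))).rootMultiplicity a * l := by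
  by_cases ha : d.eval a = 0
  · rw [ratValue_some_of_eq_zero ha] at *
    have h0 : d.eval a / n.eval a = 0 := by rw [ha, zero_div]
    have := exists_elementaryDivisors_transf (n := d) (d := n) (a := a) (hnd ha)
      (by rw [h0, C_0, zero_mul, sub_zero]; exact hne) hP.rev
    rwa [h0, C_0, zero_mul, sub_zero, transf_swap] at this
  · rw [ratValue_some_of_ne_zero ha] at *
    have hneg : fiberPoly n d (OnePoint.some (n.eval a / d.eval a)) =
        -(n - C (n.eval a / d.eval a) * d) := (neg_sub _ _).symm
    rw [hneg] at hne ⊢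
    rw [rootMultiplicity_neg]
    exact exists_elementaryDivisors_transf ha (neg_ne_zero.mp hne) hP

/-- If α d = β n, coprimality forces n and d to be constant, against G ≥ 1. -/
theorem fiberPoly_ne_zero {n d : F[X]} (hcop : IsCoprime n d) (hG : 1 ≤ ratDegree n d)
    (x₀ : OnePoint F) : fiberPoly n d x₀ ≠ 0 := by
  have hunit : ∀ {f : F[X]}, IsUnit f → f.natDegree = 0 := fun h => natDegree_eq_zero_of_isUnit h
  induction x₀ using OnePoint.rec with
  | infty =>
    intro (h : d = 0)
    rw [h, isCoprime_zero_right] at hcop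
    simp [ratDegree, h, hunit hcop] at hG
  | coe c =>
    intro (h : C c * d - n = 0)
    have hn : n = C c * d := (sub_eq_zero.mp h).symm
    have hd : IsUnit d := hcop.isUnit_of_dvd' ⟨C c, by rw [hn, mul_comm]⟩ dvd_rfl
    have h2 : n.natDegree ≤ d.natDegree := hn ▸ natDegree_C_mul_le _ _
    rw [hunit hd] at h2
    simp only [ratDegree, hunit hd] at hG
    omega

theorem natDegree_fiberPoly_le (n d : F[X]) (x₀ : OnePoint F) :
    (fiberPoly n d x₀).natDegree ≤ ratDegree n d := by
  induction x₀ using OnePoint.rec with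
  | infty => exact le_max_right _ _
  | coe c =>
    exact (natDegree_sub_le _ _).trans (max_le ((natDegree_C_mul_le _ _).trans (le_max_right _ _))
      (le_max_left _ _))

theorem natDegree_lt_iff_coeff_eq_zero {f : F[X]} {N : ℕ} (hN : 1 ≤ N) (hf : f.natDegree ≤ N) :
    f.natDegree < N ↔ f.coeff N = 0 := by
  constructor
  · exact coeff_eq_zero_of_natDegree_lt
  · intro h
    refine lt_of_le_of_ne hf fun he => ?_
    rw [← he, coeff_natDegree, leadingCoeff_eq_zero] at h
    rw [h, natDegree_zero] at he
    omega

theorem coeff_ratDegree_ne_zero {n d : F[X]} (hG : 1 ≤ ratDegree n d)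
    (h : d.coeff (ratDegree n d) = 0) : n.coeff (ratDegree n d) ≠ 0 := by
  intro h'
  have h1 := (natDegree_lt_iff_coeff_eq_zero hG (le_max_left _ _)).mpr h'
  have h2 := (natDegree_lt_iff_coeff_eq_zero hG (le_max_right _ _)).mpr h
  exact (max_lt h1 h2).ne rfl

open Classical in
-- At ∞ the degree of α d - β n drops exactly when its coefficient of y^G vanishes, and the
-- coefficients of y^G in n and d are not both zero.
theorem memFiber_iff {n d : F[X]} (hG : 1 ≤ ratDegree n d) (x₀ y₀ : OnePoint F) :
    MemFiber n d x₀ y₀ ↔ ratValue n d y₀ = x₀ := by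
  induction y₀ using OnePoint.rec with
  | coe a => exact Iff.rfl
  | infty =>
    refine (natDegree_lt_iff_coeff_eq_zero hG (natDegree_fiberPoly_le n d x₀)).trans ?_
    have hv : ratValue n d OnePoint.infty = if d.coeff (ratDegree n d) = 0 then OnePoint.infty
      else OnePoint.some (n.coeff (ratDegree n d) / d.coeff (ratDegree n d)) := rfl
    rw [hv]
    induction x₀ using OnePoint.rec with
    | infty =>
      show d.coeff _ = 0 ↔ _
      split_ifs with h
      · simp [h]
      · simp only [h, false_iff]
        exact OnePoint.coe_ne_infty _
    | coe c =>
      show (C c * d - n).coeff _ = 0 ↔ _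
      rw [coeff_sub, coeff_C_mul, sub_eq_zero]
      split_ifs with h
      · rw [h, mul_zero]
        simp only [(coeff_ratDegree_ne_zero hG h).symm, false_iff]
        exact OnePoint.infty_ne_coe _
      · refine Iff.trans ?_ OnePoint.coe_injective.eq_iff.symm
        rw [div_eq_iff h, eq_comm]

/-- The reflection is `f.reverse` times X^(N - deg f), and `f.reverse` has the nonzero constant term
`f.leadingCoeff`. -/
theorem rootMultiplicity_reflect {f : F[X]} {N : ℕ} (h0 : f ≠ 0) (hf : f.natDegree ≤ N) :
    (reflect N f).rootMultiplicity 0 = N - f.natDegree := by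
  obtain ⟨k, rfl⟩ := Nat.exists_eq_add_of_le hf
  have h1 : reflect (f.natDegree + k) f = f.reverse * X ^ k := by
    have := reflect_mul f 1 le_rfl (natDegree_one.trans_le (Nat.zero_le k))
    rw [mul_one, reflect_one] at this
    exact this
  have h2 : f.reverse.eval 0 ≠ 0 := by
    rw [← coeff_zero_eq_eval_zero, coeff_zero_reverse]
    exact leadingCoeff_ne_zero.mpr h0
  have h3 : f.reverse ≠ 0 := fun h => by simp [h] at h2
  rw [h1, ← sub_zero X, ← C_0, rootMultiplicity_mul_X_sub_C_pow h3,
    rootMultiplicity_eq_zero (p := f.reverse) h2]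
  omega

theorem eval_zero_reflect (f : F[X]) (N : ℕ) : (reflect N f).eval 0 = f.coeff N := by
  rw [← coeff_zero_eq_eval_zero, coeff_reflect, revAt_le (Nat.zero_le N), Nat.sub_zero]

theorem fiberPoly_reflect (n d : F[X]) (N : ℕ) (x₀ : OnePoint F) :
    fiberPoly (reflect N n) (reflect N d) x₀ = reflect N (fiberPoly n d x₀) := by
  induction x₀ using OnePoint.rec with
  | infty => rfl
  | coe c => exact (by rw [reflect_sub, reflect_C_mul] :
      C c * reflect N d - reflect N n = reflect N (C c * d - n))

theorem ratValue_reflect (n d : F[X]) :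
    ratValue (reflect (ratDegree n d) n) (reflect (ratDegree n d) d) (OnePoint.some 0) =
      ratValue n d OnePoint.infty := by
  unfold ratValue
  by_cases h : d.coeff (ratDegree n d) = 0 <;> simp [h, eval_zero_reflect]

theorem rev_transf {m p : ℕ} (g : ℕ) (n d : F[X]) (P : Matrix (Fin m) (Fin p) F[X]) :
    rev (g * ratDegree n d) (transf g n d P) =
      transf g (reflect (ratDegree n d) n) (reflect (ratDegree n d) d) P := by
  ext1 i j
  exact reflect_transfPoly (le_max_left _ _) (le_max_right _ _) g (P i j)

/-- The elementary divisors of `P` at `x(y₀)` and those of `Q` at `y₀` determine each other. -/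
theorem exists_elementaryDivisors {m p g : ℕ} {n d : F[X]} (hcop : IsCoprime n d)
    (hG : 1 ≤ ratDegree n d) {P : Matrix (Fin m) (Fin p) F[X]} (hP : HasGrade P g)
    (y₀ : OnePoint F) :
    ∃ L₀ : Multiset ℕ, (∀ L, HasElementaryDivisors P g (ratValue n d y₀) L ↔ L = L₀) ∧
      ∀ L, HasElementaryDivisors (transf g n d P) (g * ratDegree n d) y₀ L ↔
        L = L₀.map fun l => fiberMultiplicity n d (ratValue n d y₀) y₀ * l := by
  induction y₀ using OnePoint.rec with
  | coe a =>
    refine exists_elementaryDivisors_transf_at (fun hd hn => ?_)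
      (fiberPoly_ne_zero hcop hG _) hP
    obtain ⟨u, v, h⟩ := hcop
    have := congrArg (eval a) h
    simp [hd, hn] at this
  | infty =>
    have hne := fiberPoly_ne_zero hcop hG (ratValue n d OnePoint.infty)
    have := exists_elementaryDivisors_transf_at (n := reflect (ratDegree n d) n)
      (d := reflect (ratDegree n d) d) (a := 0)
      (by rw [eval_zero_reflect, eval_zero_reflect]; exact coeff_ratDegree_ne_zero hG)
      (by rw [ratValue_reflect, fiberPoly_reflect, Ne, reflect_eq_zero_iff]; exact hne) hP
    rw [ratValue_reflect, fiberPoly_reflect,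
      rootMultiplicity_reflect hne (natDegree_fiberPoly_le n d _), ← rev_transf] at this
    exact this

theorem fiberMultiplicity_pos {n d : F[X]} (hcop : IsCoprime n d) (hG : 1 ≤ ratDegree n d)
    {x₀ y₀ : OnePoint F} (h : MemFiber n d x₀ y₀) : 0 < fiberMultiplicity n d x₀ y₀ := by
  have hne := fiberPoly_ne_zero hcop hG x₀
  induction y₀ using OnePoint.rec with
  | infty => exact Nat.sub_pos_of_lt h
  | coe a =>
    refine (rootMultiplicity_pos hne).mpr ?_
    obtain rfl : ratValue n d (OnePoint.some a) = x₀ := h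
    by_cases ha : d.eval a = 0
    · rw [ratValue_some_of_eq_zero ha]
      exact ha
    · rw [ratValue_some_of_ne_zero ha]
      show (C _ * d - n).eval a = 0
      rw [eval_sub, eval_mul, eval_C, div_mul_cancel₀ _ ha, sub_self]

end Points

/-! ### Expansions in powers of `n` and `d` -/

section Expansion

variable {F : Type*} [Field F] {n d : F[X]}

/-- Modulo d only the top term survives, so d divides h k · n^k, hence h k, which is zero by degree.
Then d cancels and induction applies. -/
theorem eq_zero_of_sum_mul_pow_eq_zero_of_natDegree_lt (hcop : IsCoprime n d)
    (k : ℕ) (h : ℕ → F[X]) (hdeg : ∀ i, (h i).natDegree < d.natDegree)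
    (hsum : ∑ i ∈ Finset.range (k + 1), h i * n ^ i * d ^ (k - i) = 0) :
    ∀ i ≤ k, h i = 0 := by
  have hd0 : d ≠ 0 := fun hd => by simpa [hd] using hdeg 0
  induction k with
  | zero =>
    intro i hi
    obtain rfl : i = 0 := by omega
    simpa using hsum
  | succ k ih =>
    have hsplit : ∑ i ∈ Finset.range (k + 1), h i * n ^ i * d ^ (k + 1 - i) =
        d * ∑ i ∈ Finset.range (k + 1), h i * n ^ i * d ^ (k - i) := by
      rw [Finset.mul_sum]
      refine Finset.sum_congr rfl fun i hi => ?_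
      rw [Nat.succ_sub (Nat.lt_succ_iff.mp (Finset.mem_range.mp hi)), pow_succ]
      ring
    rw [Finset.sum_range_succ, hsplit, Nat.sub_self, pow_zero, mul_one] at hsum
    have hlast : h (k + 1) = 0 := by
      have hdvd : d ∣ h (k + 1) * n ^ (k + 1) :=
        (dvd_add_right (dvd_mul_right d _)).mp (hsum ▸ dvd_zero d)
      refine eq_zero_of_dvd_of_natDegree_lt (p := d) ?_ (hdeg _)
      exact hcop.symm.pow_right.dvd_of_dvd_mul_right hdvd
    rw [hlast, zero_mul, add_zero, mul_eq_zero, or_iff_right hd0] at hsum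
    intro i hi
    rcases Nat.lt_or_eq_of_le hi with hlt | rfl
    · exact ih hsum i (by omega)
    · exact hlast

/-- The sum is symmetric in n and d up to i ↦ k - i, so whichever has degree G can play the divisor.
-/
theorem eq_zero_of_sum_mul_pow_eq_zero (hcop : IsCoprime n d) (k : ℕ) (h : ℕ → F[X])
    (hdeg : ∀ i, (h i).natDegree < ratDegree n d)
    (hsum : ∑ i ∈ Finset.range (k + 1), h i * n ^ i * d ^ (k - i) = 0) :
    ∀ i ≤ k, h i = 0 := by
  rcases max_choice n.natDegree d.natDegree with hG | hG
  · have hsum' : ∑ i ∈ Finset.range (k + 1), h (k - i) * d ^ i * n ^ (k - i) = 0 := by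
      rw [← hsum, ← Finset.sum_range_reflect]
      refine Finset.sum_congr rfl fun i hi => ?_
      have hi' : i ≤ k := Nat.lt_succ_iff.mp (Finset.mem_range.mp hi)
      rw [show k + 1 - 1 - i = k - i by omega, Nat.sub_sub_self hi']
      ring
    have := eq_zero_of_sum_mul_pow_eq_zero_of_natDegree_lt hcop.symm k (fun i => h (k - i))
      (fun i => (hdeg _).trans_eq hG) hsum'
    intro i hi
    have h2 := this (k - i) (Nat.sub_le _ _)
    rwa [Nat.sub_sub_self hi] at h2
  · exact eq_zero_of_sum_mul_pow_eq_zero_of_natDegree_lt hcop k h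
      (fun i => (hdeg i).trans_eq hG) hsum

/-- `1, y, …, y^(G-1)` are independent over the polynomials in `n / d`. -/
theorem eq_zero_of_sum_X_pow_mul_transfPoly_eq_zero (hcop : IsCoprime n d)
    (hG : 1 ≤ ratDegree n d) {k : ℕ} {f : ℕ → F[X]} (hf : ∀ j, (f j).natDegree ≤ k)
    (hsum : ∑ j ∈ Finset.range (ratDegree n d), X ^ j * transfPoly k n d (f j) = 0) :
    ∀ j < ratDegree n d, f j = 0 := by
  set G := ratDegree n d with hGdef
  -- The double sum is regrouped by n^i d^(k-i); the coefficients h i then have degree less than G.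
  let h : ℕ → F[X] := fun i => ∑ j ∈ Finset.range G, C ((f j).coeff i) * X ^ j
  have hdeg : ∀ i, (h i).natDegree < G := fun i => by
    have : (h i).natDegree ≤ G - 1 := by
      refine natDegree_sum_le_of_forall_le _ _ fun j hj => (natDegree_C_mul_X_pow_le _ _).trans ?_
      have := Finset.mem_range.mp hj
      omega
    omega
  have hh : ∑ i ∈ Finset.range (k + 1), h i * n ^ i * d ^ (k - i) = 0 := by
    rw [← hsum]
    simp only [h, transfPoly, Finset.mul_sum, Finset.sum_mul]
    rw [Finset.sum_comm]
    exact Finset.sum_congr rfl fun j _ => Finset.sum_congr rfl fun i _ => by ring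
  have hz := eq_zero_of_sum_mul_pow_eq_zero hcop k h hdeg hh
  intro j hj
  ext i
  rw [coeff_zero]
  by_cases hi : i ≤ k
  · have := congrArg (fun q => coeff q j) (hz i hi)
    simpa [h, finsetSum_coeff, coeff_C_mul, coeff_X_pow, hj] using this
  · exact coeff_eq_zero_of_natDegree_lt ((hf j).trans_lt (by omega))

theorem transfPoly_ne_zero (hcop : IsCoprime n d) (hG : 1 ≤ ratDegree n d) {k : ℕ} {f : F[X]}
    (hf : f.natDegree ≤ k) (h0 : f ≠ 0) : transfPoly k n d f ≠ 0 := by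
  intro h
  refine h0 ?_
  have := eq_zero_of_sum_X_pow_mul_transfPoly_eq_zero hcop hG (k := k)
    (f := fun j => if j = 0 then f else 0) (fun j => by split_ifs <;> simp [hf]) ?_ 0 hG
  · simpa using this
  · refine Finset.sum_eq_zero fun j _ => ?_
    split_ifs
    · rw [h, mul_zero]
    · rw [transfPoly_zero, mul_zero]

theorem transfPoly_smul (g : ℕ) (n d f : F[X]) (c : F) :
    transfPoly g n d (c • f) = c • transfPoly g n d f := by
  rw [transfPoly, transfPoly, Finset.smul_sum]
  refine Finset.sum_congr rfl fun i _ => ?_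
  rw [coeff_smul, smul_eq_mul, C_mul, smul_eq_C_mul, mul_assoc, mul_assoc, mul_assoc]

/-- Every polynomial is a combination of `1, y, …, y^(G-1)` with coefficients that are polynomials
in `n / d`. -/
theorem exists_eq_sum_X_pow_mul_transfPoly (hcop : IsCoprime n d) (hG : 1 ≤ ratDegree n d)
    {k : ℕ} {w : F[X]} (hw : w.natDegree < ratDegree n d * (k + 1)) :
    ∃ f : ℕ → F[X], (∀ j, (f j).natDegree ≤ k) ∧
      w = ∑ j ∈ Finset.range (ratDegree n d), X ^ j * transfPoly k n d (f j) := by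
  set G := ratDegree n d with hGdef
  have hlt : ∀ {f : F[X]} {N : ℕ}, f ∈ degreeLT F (N + 1) ↔ f.natDegree ≤ N := fun {f N} => by
    rw [mem_degreeLT, degree_lt_iff_coeff_zero, natDegree_le_iff_coeff_eq_zero]
    rfl
  have hpos : G * (k + 1) - 1 + 1 = G * (k + 1) :=
    Nat.sub_add_cancel (Nat.mul_pos hG (Nat.succ_pos k))
  -- Both sides have dimension G(k+1), so the injectivity given by uniqueness yields surjectivity.
  -- Degrees fit: j + kG < G(k+1).
  let Φ : (Fin G → degreeLT F (k + 1)) →ₗ[F] degreeLT F (G * (k + 1)) :=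
    { toFun := fun f => ⟨∑ j : Fin G, X ^ (j : ℕ) * transfPoly k n d (f j), by
        rw [← hpos, hlt]
        refine natDegree_sum_le_of_forall_le _ _ fun j _ => ?_
        refine (natDegree_mul_le_of_le (natDegree_X_pow_le _) (natDegree_transfPoly_le k n d _)).trans ?_
        rw [← hGdef, mul_add, mul_one, mul_comm G k]
        have := j.2
        omega⟩
      map_add' := fun f f' => Subtype.ext (by
        simp only [Pi.add_apply, Submodule.coe_add, transfPoly_add, mul_add,
          Finset.sum_add_distrib])
      map_smul' := fun c f => Subtype.ext (by
        simp only [Pi.smul_apply, Submodule.coe_smul, transfPoly_smul, Finset.smul_sum,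
          mul_smul_comm, RingHom.id_apply]) }
  have hinj : Function.Injective Φ := by
    rw [← LinearMap.ker_eq_bot, LinearMap.ker_eq_bot']
    intro f hf
    have hf' : ∑ j : Fin G, X ^ (j : ℕ) * transfPoly k n d (f j) = 0 := congrArg Subtype.val hf
    have := eq_zero_of_sum_X_pow_mul_transfPoly_eq_zero hcop hG (k := k)
      (f := fun j => if hj : j < G then f ⟨j, hj⟩ else 0) (fun j => by
        split_ifs
        · exact hlt.mp (Subtype.prop _)
        · simp) (by
        rw [Finset.sum_range, ← hf']
        exact Finset.sum_congr rfl fun j _ => by rw [dif_pos j.2])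
    funext j
    have h2 := this j j.2
    rw [dif_pos j.2] at h2
    exact Subtype.ext h2
  have hfin : Module.finrank F (Fin G → degreeLT F (k + 1)) =
      Module.finrank F (degreeLT F (G * (k + 1))) := by
    rw [Module.finrank_pi_fintype]
    simp [(degreeLTEquiv F _).finrank_eq]
  have : ∀ N, FiniteDimensional F (degreeLT F N) := fun N =>
    (degreeLTEquiv F N).symm.finiteDimensional
  have hsurj := (LinearMap.injective_iff_surjective_of_finrank_eq_finrank hfin).mp hinj
  obtain ⟨f, hf⟩ := hsurj ⟨w, by rw [← hpos, hlt]; omega⟩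
  have hf' : ∑ j : Fin G, X ^ (j : ℕ) * transfPoly k n d (f j) = w := congrArg Subtype.val hf
  refine ⟨fun j => if hj : j < G then f ⟨j, hj⟩ else 0, fun j => ?_, ?_⟩
  · dsimp only
    split_ifs
    · exact hlt.mp (Subtype.prop _)
    · simp
  · rw [Finset.sum_range, ← hf']
    exact Finset.sum_congr rfl fun j _ => by simp only [j.2, dif_pos]

end Expansion

/-! ### Minimal indices and the span of the polynomial vectors of bounded degree -/

section MinimalIndices

variable {F : Type*} [Field F] {p : ℕ}

/-- The span of the polynomial vectors of degree at most `d` in `V`. -/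
def polySpan (V : Submodule (RatFunc F) (Fin p → RatFunc F)) (d : ℕ) :
    Submodule (RatFunc F) (Fin p → RatFunc F) :=
  Submodule.span (RatFunc F) (toRat '' {w | toRat w ∈ V ∧ vecDegree w ≤ d})

theorem vecDegree_le_iff {v : Fin p → F[X]} {e : ℕ} :
    vecDegree v ≤ e ↔ ∀ j, (v j).natDegree ≤ e := by
  simp [vecDegree, Finset.sup_le_iff]

theorem exists_smul_eq_toRat {ι : Type*} [Finite ι] (a : ι → RatFunc F) :
    ∃ (b : F[X]) (c : ι → F[X]), b ≠ 0 ∧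
      ∀ i, algebraMap F[X] (RatFunc F) b * a i = algebraMap F[X] (RatFunc F) (c i) := by
  obtain ⟨b, hb⟩ := IsLocalization.exist_integer_multiples_of_finite (nonZeroDivisors F[X]) a
  choose c hc using hb
  exact ⟨b, c, nonZeroDivisors.coe_ne_zero b, fun i => by rw [hc i, Algebra.smul_def]⟩

theorem exists_toRat_basis (S : Set (Fin p → F[X])) :
    ∃ (r : ℕ) (v : Fin r → Fin p → F[X]), (∀ i, v i ∈ S) ∧
      LinearIndependent (RatFunc F) (fun i => toRat (v i)) ∧
      Submodule.span (RatFunc F) (Set.range fun i => toRat (v i)) =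
        Submodule.span (RatFunc F) (toRat '' S) := by
  obtain ⟨b, hbS, hspan, hli⟩ := exists_linearIndependent (RatFunc F) (toRat '' S)
  have : Finite b := hli.finite
  obtain ⟨r, ⟨e⟩⟩ := Finite.exists_equiv_fin b
  choose v hvS hv using fun x : b => hbS x.2
  refine ⟨r, fun i => v (e.symm i), fun i => hvS _, ?_, ?_⟩
  · simp only [hv]
    exact hli.comp e.symm e.symm.injective
  · simp only [hv]
    rw [← hspan]
    congr 1
    ext x
    constructor
    · rintro ⟨i, rfl⟩
      exact (e.symm i).2
    · intro hx
      exact ⟨e ⟨x, hx⟩, by simp⟩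

theorem span_toRat_eq (V : Submodule (RatFunc F) (Fin p → RatFunc F)) :
    Submodule.span (RatFunc F) (toRat '' {w | toRat w ∈ V}) = V := by
  apply le_antisymm
  · rw [Submodule.span_le]
    rintro _ ⟨w, hw, rfl⟩
    exact hw
  · intro x hx
    obtain ⟨b, c, hb, hc⟩ := exists_smul_eq_toRat x
    have hb' : algebraMap F[X] (RatFunc F) b ≠ 0 := by simpa using hb
    have hcx : algebraMap F[X] (RatFunc F) b • x = toRat c := funext hc
    have hx' : x = (algebraMap F[X] (RatFunc F) b)⁻¹ • toRat c := by
      rw [← hcx, inv_smul_smul₀ hb']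
    rw [hx']
    refine Submodule.smul_mem _ _ (Submodule.subset_span ⟨c, ?_, rfl⟩)
    show toRat c ∈ V
    rw [← hcx]
    exact V.smul_mem _ hx

theorem exists_isMinimalBasis (V : Submodule (RatFunc F) (Fin p → RatFunc F)) :
    ∃ (s : ℕ) (v : Fin s → Fin p → F[X]), IsMinimalBasis V v := by
  classical
  obtain ⟨s, v, -, hli, hspan⟩ := exists_toRat_basis {w | toRat w ∈ V}
  rw [span_toRat_eq] at hspan
  have hex : ∃ N, ∃ v : Fin s → Fin p → F[X], IsPolynomialBasis V v ∧ order v = N :=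
    ⟨_, v, ⟨hli, hspan⟩, rfl⟩
  obtain ⟨w, hw, hN⟩ := Nat.find_spec hex
  exact ⟨s, w, hw, fun u hu => hN ▸ Nat.find_min' hex ⟨u, hu, rfl⟩⟩

/-- Steinitz exchange. Independence follows by counting: the new family spans V with the same number
of vectors. -/
theorem IsPolynomialBasis.update {V : Submodule (RatFunc F) (Fin p → RatFunc F)} {s : ℕ}
    {v : Fin s → Fin p → F[X]} (hv : IsPolynomialBasis V v) {u : Fin p → F[X]}
    {c : Fin s → RatFunc F} (hu : ∑ i, c i • toRat (v i) = toRat u) {i₀ : Fin s} (h0 : c i₀ ≠ 0) :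
    IsPolynomialBasis V (Function.update v i₀ u) := by
  obtain ⟨hli, hspan⟩ := hv
  have hmem : ∀ i, toRat (v i) ∈ V := fun i => by
    rw [← hspan]; exact Submodule.subset_span ⟨i, rfl⟩
  have hspan' : Submodule.span (RatFunc F)
      (Set.range fun i => toRat (Function.update v i₀ u i)) = V := by
    apply le_antisymm
    · rw [Submodule.span_le]
      rintro _ ⟨i, rfl⟩
      by_cases hi : i = i₀
      · subst hi
        simp only [Function.update_self, ← hu]
        exact V.sum_mem fun i _ => V.smul_mem _ (hmem i)
      · simp only [Function.update_of_ne hi]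
        exact hmem i
    · set W := Submodule.span (RatFunc F) (Set.range fun i => toRat (Function.update v i₀ u i))
      have hne : ∀ i, i ≠ i₀ → toRat (v i) ∈ W := fun i hi =>
        Submodule.subset_span ⟨i, by simp only [Function.update_of_ne hi]⟩
      have hu' : toRat u ∈ W := Submodule.subset_span ⟨i₀, by simp only [Function.update_self]⟩
      have hi₀ : toRat (v i₀) ∈ W := by
        have h1 : c i₀ • toRat (v i₀) ∈ W := by
          rw [← Finset.add_sum_erase _ _ (Finset.mem_univ i₀)] at hu
          rw [eq_sub_of_add_eq hu]
          exact W.sub_mem hu' (W.sum_mem fun i hi => W.smul_mem _ (hne i (Finset.ne_of_mem_erase hi)))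
        exact (W.smul_mem_iff h0).mp h1
      conv_lhs => rw [← hspan]
      rw [Submodule.span_le]
      rintro _ ⟨i, rfl⟩
      by_cases hi : i = i₀
      · rw [hi]; exact hi₀
      · exact hne i hi
  refine ⟨?_, hspan'⟩
  rw [linearIndependent_iff_card_eq_finrank_span] at hli ⊢
  rw [Set.finrank, hspan']
  rwa [Set.finrank, hspan] at hli

theorem order_update_lt {s : ℕ} {v : Fin s → Fin p → F[X]} {u : Fin p → F[X]} {i₀ : Fin s}
    (h : vecDegree u < vecDegree (v i₀)) : order (Function.update v i₀ u) < order v := by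
  refine Finset.sum_lt_sum (fun i _ => ?_) ⟨i₀, Finset.mem_univ _, ?_⟩
  · by_cases hi : i = i₀
    · subst hi
      rw [Function.update_self]
      exact h.le
    · rw [Function.update_of_ne hi]
  · rwa [Function.update_self]

/-- If a vector of V of degree at most e involved a basis vector of larger degree, exchanging the
two would lower the order. So the basis vectors of degree at most e span `polySpan V e`. -/
theorem IsMinimalBasis.card_filter_eq {V : Submodule (RatFunc F) (Fin p → RatFunc F)} {s : ℕ}
    {v : Fin s → Fin p → F[X]} (hv : IsMinimalBasis V v) (e : ℕ) :
    (Finset.univ.filter fun i => vecDegree (v i) ≤ e).card =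
      Module.finrank (RatFunc F) (polySpan V e) := by
  have hmem : ∀ i, toRat (v i) ∈ V := fun i => by
    rw [← hv.1.2]; exact Submodule.subset_span ⟨i, rfl⟩
  have hspan : polySpan V e = Submodule.span (RatFunc F)
      (Set.range fun i : {i // vecDegree (v i) ≤ e} => toRat (v i)) := by
    apply le_antisymm
    · rw [polySpan, Submodule.span_le]
      rintro _ ⟨u, ⟨huV, hue⟩, rfl⟩
      rw [← hv.1.2, Submodule.mem_span_range_iff_exists_fun] at huV
      obtain ⟨c, hc⟩ := huV
      rw [← hc]
      refine Submodule.sum_mem _ fun i _ => ?_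
      by_cases hi : vecDegree (v i) ≤ e
      · exact Submodule.smul_mem _ _ (Submodule.subset_span ⟨⟨i, hi⟩, rfl⟩)
      · by_cases hci : c i = 0
        · rw [hci, zero_smul]
          exact Submodule.zero_mem _
        · have h1 := hv.2 _ (hv.1.update hc hci)
          have h2 := order_update_lt (v := v) (u := u) (i₀ := i) (by omega)
          omega
    · rw [Submodule.span_le]
      rintro _ ⟨i, rfl⟩
      exact Submodule.subset_span ⟨v i, ⟨hmem i, i.2⟩, rfl⟩
  have hli : LinearIndependent (RatFunc F)
      fun i : {i // vecDegree (v i) ≤ e} => toRat (v i) := hv.1.1.comp _ Subtype.val_injective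
  rw [hspan, finrank_span_eq_card hli, Fintype.card_subtype]

theorem eq_of_countP_le_eq {β β' : Multiset ℕ}
    (h : ∀ e, β.countP (· ≤ e) = β'.countP (· ≤ e)) : β = β' := by
  have key : ∀ (γ : Multiset ℕ) (e : ℕ),
      γ.countP (· ≤ e + 1) = γ.countP (· ≤ e) + γ.count (e + 1) := fun γ e => by
    induction γ using Multiset.induction with
    | empty => simp
    | cons a γ ih =>
      rw [Multiset.countP_cons, Multiset.countP_cons, Multiset.count_cons, ih]
      split_ifs <;> omega
  have key0 : ∀ γ : Multiset ℕ, γ.countP (· ≤ 0) = γ.count 0 := fun γ => by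
    simp only [Multiset.count, nonpos_iff_eq_zero, eq_comm]
  ext e
  cases e with
  | zero => rw [← key0, ← key0, h]
  | succ e =>
    have h1 := key β e
    have h2 := key β' e
    rw [h, h] at h1
    omega

/-- Minimal bases are traded for dimensions; this also shows that the indices do not depend on the
basis. -/
theorem hasMinimalIndices_iff (V : Submodule (RatFunc F) (Fin p → RatFunc F)) (β : Multiset ℕ) :
    HasMinimalIndices V β ↔
      ∀ e, β.countP (· ≤ e) = Module.finrank (RatFunc F) (polySpan V e) := by
  have key : ∀ {s : ℕ} {v : Fin s → Fin p → F[X]}, IsMinimalBasis V v → ∀ e,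
      (Finset.univ.val.map fun i => vecDegree (v i)).countP (· ≤ e) =
        Module.finrank (RatFunc F) (polySpan V e) := fun hv e => by
    rw [← hv.card_filter_eq e, Multiset.countP_map]
    rfl
  constructor
  · rintro ⟨s, v, hv, rfl⟩
    exact key hv
  · intro h
    obtain ⟨s, v, hv⟩ := exists_isMinimalBasis V
    exact ⟨s, v, hv, eq_of_countP_le_eq fun e => by rw [h, key hv]⟩

end MinimalIndices

/-! ### The minimal indices of the transformed matrix -/

section TransfKernel

variable {F : Type*} [Field F] {m p : ℕ} {n d : F[X]}

/-- The transform of a polynomial vector of grade `k`. -/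
def transfVec (k : ℕ) (n d : F[X]) (v : Fin p → F[X]) : Fin p → F[X] :=
  fun l => transfPoly k n d (v l)

/-- `toRat` as a linear map. -/
def toRatLinear (F : Type*) [Field F] (p : ℕ) : (Fin p → F[X]) →ₗ[F[X]] (Fin p → RatFunc F) where
  toFun := toRat
  map_add' v w := funext fun j => map_add _ _ _
  map_smul' c v := funext fun j => by
    change algebraMap F[X] (RatFunc F) (c * v j) = c • algebraMap F[X] (RatFunc F) (v j)
    rw [map_mul, Algebra.smul_def]

theorem toRat_injective : Function.Injective (toRat : (Fin p → F[X]) → Fin p → RatFunc F) :=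
  fun _ _ h => funext fun j => IsFractionRing.injective F[X] (RatFunc F) (congrFun h j)

theorem linearIndependent_toRat_iff {ι : Type*} {v : ι → Fin p → F[X]} :
    LinearIndependent (RatFunc F) (fun i => toRat (v i)) ↔ LinearIndependent F[X] v := by
  rw [← LinearIndependent.iff_fractionRing F[X] (RatFunc F)]
  exact LinearMap.linearIndependent_iff (toRatLinear F p)
    (LinearMap.ker_eq_bot.mpr toRat_injective)

theorem toRat_mem_ratKer_iff {P : Matrix (Fin m) (Fin p) F[X]} {v : Fin p → F[X]} :
    toRat v ∈ ratKer P ↔ ∀ i, ∑ l, P i l * v l = 0 := by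
  rw [ratKer, LinearMap.mem_ker, Matrix.mulVecLin_apply, funext_iff]
  refine forall_congr' fun i => ?_
  have : (P.map (algebraMap F[X] (RatFunc F))).mulVec (toRat v) i =
      algebraMap F[X] (RatFunc F) (∑ l, P i l * v l) := by
    simp [Matrix.mulVec, dotProduct, toRat]
  rw [this, Pi.zero_apply]
  exact map_eq_zero_iff _ (IsFractionRing.injective F[X] (RatFunc F))

theorem ne_zero_of_isCoprime (hcop : IsCoprime n d) (hG : 1 ≤ ratDegree n d) : d ≠ 0 :=
  fiberPoly_ne_zero hcop hG OnePoint.infty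

/-- Splits a relation with transformed coefficients into G separate relations over F[x], one for
each power y^j. -/
theorem sum_X_pow_mul_transfPoly_mul {ι : Type*} (s : Finset ι) {a k G : ℕ} (hd : d ≠ 0)
    {f : ι → F[X]} {c : ι → ℕ → F[X]} (hf : ∀ i, (f i).natDegree ≤ a)
    (hc : ∀ i j, (c i j).natDegree ≤ k) :
    ∑ i ∈ s, transfPoly a n d (f i) * ∑ j ∈ Finset.range G, X ^ j * transfPoly k n d (c i j) =
      ∑ j ∈ Finset.range G, X ^ j * transfPoly (a + k) n d (∑ i ∈ s, f i * c i j) := by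
  simp only [Finset.mul_sum, transfPoly_sum]
  rw [Finset.sum_comm]
  refine Finset.sum_congr rfl fun j _ => Finset.sum_congr rfl fun i _ => ?_
  rw [transfPoly_mul hd (hf i) (hc i j)]
  ring

theorem natDegree_sum_mul_le {ι : Type*} (s : Finset ι) {a b : ℕ} {f h : ι → F[X]}
    (hf : ∀ i, (f i).natDegree ≤ a) (hh : ∀ i, (h i).natDegree ≤ b) :
    (∑ i ∈ s, f i * h i).natDegree ≤ a + b :=
  natDegree_sum_le_of_forall_le _ _ fun i _ => natDegree_mul_le_of_le (hf i) (hh i)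

/-- Expanding the coefficients of a relation in y^j splits it into transforms of relations among the
v i, all of which are trivial. -/
theorem LinearIndependent.transfVec (hcop : IsCoprime n d) (hG : 1 ≤ ratDegree n d) {r k : ℕ}
    {v : Fin r → Fin p → F[X]} (hv : ∀ i, vecDegree (v i) ≤ k) (hli : LinearIndependent F[X] v) :
    LinearIndependent F[X] fun i => RatTransf.transfVec k n d (v i) := by
  rw [Fintype.linearIndependent_iff] at hli ⊢
  intro c hc
  have hdeg : ∀ i, (c i).natDegree < ratDegree n d * (vecDegree c + 1) := fun i =>
    (Nat.lt_succ_of_le (vecDegree_le_iff.mp le_rfl i)).trans_le (Nat.le_mul_of_pos_left _ hG)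
  choose f hf hcf using fun i => exists_eq_sum_X_pow_mul_transfPoly hcop hG (hdeg i)
  have hv' : ∀ l i, (v i l).natDegree ≤ k := fun l i => vecDegree_le_iff.mp (hv i) l
  have hz : ∀ l, ∀ j < ratDegree n d, ∑ i, v i l * f i j = 0 := fun l => by
    refine eq_zero_of_sum_X_pow_mul_transfPoly_eq_zero hcop hG (k := k + vecDegree c)
      (fun j => natDegree_sum_mul_le _ (hv' l) fun i => hf i j) ?_
    rw [← sum_X_pow_mul_transfPoly_mul _ (ne_zero_of_isCoprime hcop hG) (hv' l) hf]
    have := congrFun hc l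
    rw [Finset.sum_apply] at this
    refine Eq.trans (Finset.sum_congr rfl fun i _ => ?_) this
    rw [← hcf, mul_comm]
    rfl
  intro i
  rw [hcf i]
  refine Finset.sum_eq_zero fun j hj => ?_
  have : f i j = 0 := hli (fun i => f i j) (by
    funext l
    rw [Finset.sum_apply]
    refine Eq.trans (Finset.sum_congr rfl fun i _ => ?_) (hz l j (Finset.mem_range.mp hj))
    exact mul_comm _ _) i
  rw [this, transfPoly_zero, mul_zero]

/-- Clearing denominators gives b f = ∑ c i v i. Transforming with a common grade D for b and c
keeps the relation, and the transform of b is nonzero. -/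
theorem toRat_transfVec_mem_span (hcop : IsCoprime n d) (hG : 1 ≤ ratDegree n d) {r k : ℕ}
    {v : Fin r → Fin p → F[X]} (hv : ∀ i, vecDegree (v i) ≤ k) {f : Fin p → F[X]}
    (hf : vecDegree f ≤ k)
    (hmem : toRat f ∈ Submodule.span (RatFunc F) (Set.range fun i => toRat (v i))) :
    toRat (transfVec k n d f) ∈
      Submodule.span (RatFunc F) (Set.range fun i => toRat (transfVec k n d (v i))) := by
  have hd := ne_zero_of_isCoprime hcop hG
  rw [Submodule.mem_span_range_iff_exists_fun] at hmem
  obtain ⟨a, ha⟩ := hmem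
  obtain ⟨b, c, hb, hc⟩ := exists_smul_eq_toRat a
  have hrel : ∀ l, b * f l = ∑ i, c i * v i l := fun l => by
    apply IsFractionRing.injective F[X] (RatFunc F)
    have := congrFun ha l
    rw [Finset.sum_apply] at this
    rw [map_mul, map_sum]
    change _ * toRat f l = _
    rw [← this, Finset.mul_sum]
    refine Finset.sum_congr rfl fun i _ => ?_
    rw [map_mul, ← hc, mul_assoc]
    rfl
  set D := max b.natDegree (vecDegree c)
  have hbD : b.natDegree ≤ D := le_max_left _ _
  have hcD : ∀ i, (c i).natDegree ≤ D := vecDegree_le_iff.mp (le_max_right _ _)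
  have hrel' : ∀ l, transfPoly D n d b * transfPoly k n d (f l) =
      ∑ i, transfPoly D n d (c i) * transfPoly k n d (v i l) := fun l => by
    rw [← transfPoly_mul hd hbD (vecDegree_le_iff.mp hf l), hrel l, transfPoly_sum]
    exact Finset.sum_congr rfl fun i _ => transfPoly_mul hd (hcD i) (vecDegree_le_iff.mp (hv i) l)
  have hb0 : algebraMap F[X] (RatFunc F) (transfPoly D n d b) ≠ 0 := by
    rw [Ne, map_eq_zero_iff _ (IsFractionRing.injective F[X] (RatFunc F))]
    exact transfPoly_ne_zero hcop hG hbD hb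
  rw [← Submodule.smul_mem_iff _ hb0]
  have : algebraMap F[X] (RatFunc F) (transfPoly D n d b) • toRat (transfVec k n d f) =
      ∑ i, algebraMap F[X] (RatFunc F) (transfPoly D n d (c i)) •
        toRat (transfVec k n d (v i)) := by
    funext l
    rw [Finset.sum_apply]
    have := congrArg (algebraMap F[X] (RatFunc F)) (hrel' l)
    rw [map_mul, map_sum] at this
    refine this.trans (Finset.sum_congr rfl fun i _ => ?_)
    exact map_mul _ _ _
  rw [this]
  exact Submodule.sum_mem _ fun i _ =>
    Submodule.smul_mem _ _ (Submodule.subset_span ⟨i, rfl⟩)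

theorem toRat_transfVec_mem_ratKer (hd : d ≠ 0) {g k : ℕ} {P : Matrix (Fin m) (Fin p) F[X]}
    (hP : HasGrade P g) {f : Fin p → F[X]} (hf : vecDegree f ≤ k) (h : toRat f ∈ ratKer P) :
    toRat (transfVec k n d f) ∈ ratKer (transf g n d P) := by
  rw [toRat_mem_ratKer_iff] at h ⊢
  intro i
  have h2 := congrArg (transfPoly (g + k) n d) (h i)
  rw [transfPoly_zero, transfPoly_sum] at h2
  rw [← h2]
  exact Finset.sum_congr rfl fun l _ =>
    (transfPoly_mul hd (hP i l) (vecDegree_le_iff.mp hf l)).symm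

/-- Expanding w entrywise turns Q w = 0 into a y^j-expansion of zero whose components are transforms
of P f j; uniqueness kills each. -/
theorem exists_eq_sum_transfVec (hcop : IsCoprime n d) (hG : 1 ≤ ratDegree n d) {g k : ℕ}
    {P : Matrix (Fin m) (Fin p) F[X]} (hP : HasGrade P g) {w : Fin p → F[X]}
    (hw : ∀ l, (w l).natDegree < ratDegree n d * (k + 1)) (h : toRat w ∈ ratKer (transf g n d P)) :
    ∃ f : ℕ → Fin p → F[X], (∀ j, vecDegree (f j) ≤ k) ∧
      (∀ j < ratDegree n d, toRat (f j) ∈ ratKer P) ∧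
      ∀ l, w l = ∑ j ∈ Finset.range (ratDegree n d), X ^ j * transfVec k n d (f j) l := by
  choose f hf hwf using fun l => exists_eq_sum_X_pow_mul_transfPoly hcop hG (hw l)
  refine ⟨fun j l => f l j, fun j => vecDegree_le_iff.mpr fun l => hf l j, fun j hj => ?_, hwf⟩
  rw [toRat_mem_ratKer_iff] at h ⊢
  intro i
  refine eq_zero_of_sum_X_pow_mul_transfPoly_eq_zero hcop hG (k := g + k)
    (f := fun j => ∑ l, P i l * f l j)
    (fun j => natDegree_sum_mul_le _ (hP i) fun l => hf l j) ?_ j hj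
  rw [← sum_X_pow_mul_transfPoly_mul _ (ne_zero_of_isCoprime hcop hG) (hP i) hf, ← h i]
  exact Finset.sum_congr rfl fun l _ => by rw [← hwf]; rfl

theorem finrank_polySpan_transf (hcop : IsCoprime n d) (hG : 1 ≤ ratDegree n d) {g : ℕ}
    {P : Matrix (Fin m) (Fin p) F[X]} (hP : HasGrade P g) (e : ℕ) :
    Module.finrank (RatFunc F) (polySpan (ratKer (transf g n d P)) e) =
      Module.finrank (RatFunc F) (polySpan (ratKer P) (e / ratDegree n d)) := by
  -- Both bounds on k = ⌊e/G⌋ are used: e < G(k+1) to expand vectors of degree at most e, and kG ≤ e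
  -- to bound the degrees of transforms.
  set k := e / ratDegree n d with hk
  obtain ⟨r, v, hvS, hli, hspan⟩ := exists_toRat_basis {w | toRat w ∈ ratKer P ∧ vecDegree w ≤ k}
  have hli' : LinearIndependent (RatFunc F) fun i => toRat (transfVec k n d (v i)) :=
    linearIndependent_toRat_iff.mpr
      (LinearIndependent.transfVec hcop hG (fun i => (hvS i).2) (linearIndependent_toRat_iff.mp hli))
  have hspan' : polySpan (ratKer (transf g n d P)) e =
      Submodule.span (RatFunc F) (Set.range fun i => toRat (transfVec k n d (v i))) := by
    apply le_antisymm
    · rw [polySpan, Submodule.span_le]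
      rintro _ ⟨w, ⟨hwQ, hwe⟩, rfl⟩
      obtain ⟨f, hfk, hfP, hwf⟩ := exists_eq_sum_transfVec hcop hG (k := k) hP (w := w) (fun l =>
        (vecDegree_le_iff.mp hwe l).trans_lt (Nat.lt_mul_div_succ e hG)) hwQ
      have : toRat w = ∑ j ∈ Finset.range (ratDegree n d),
          algebraMap F[X] (RatFunc F) (X ^ j) • toRat (transfVec k n d (f j)) := by
        funext l
        rw [Finset.sum_apply, toRat, hwf l, map_sum]
        exact Finset.sum_congr rfl fun j _ => map_mul _ _ _
      rw [this]
      refine Submodule.sum_mem _ fun j hj => Submodule.smul_mem _ _ ?_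
      refine toRat_transfVec_mem_span hcop hG (fun i => (hvS i).2) (hfk j) ?_
      rw [hspan]
      exact Submodule.subset_span ⟨f j, ⟨hfP j (Finset.mem_range.mp hj), hfk j⟩, rfl⟩
    · rw [Submodule.span_le]
      rintro _ ⟨i, rfl⟩
      refine Submodule.subset_span ⟨_, ⟨toRat_transfVec_mem_ratKer (ne_zero_of_isCoprime hcop hG) hP
        (hvS i).2 (hvS i).1, vecDegree_le_iff.mpr fun l => ?_⟩, rfl⟩
      exact (natDegree_transfPoly_le k n d _).trans (Nat.div_mul_le_self e _)
  rw [hspan', finrank_span_eq_card hli', polySpan, ← hspan, finrank_span_eq_card hli]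

theorem hasRightMinimalIndices_transf_iff (hcop : IsCoprime n d) (hG : 1 ≤ ratDegree n d) {g : ℕ}
    {P : Matrix (Fin m) (Fin p) F[X]} (hP : HasGrade P g) (β : Multiset ℕ) :
    HasRightMinimalIndices P β ↔
      HasRightMinimalIndices (transf g n d P) (β.map fun b => ratDegree n d * b) := by
  have hcount : ∀ e, (β.map fun b => ratDegree n d * b).countP (· ≤ e) =
      β.countP (· ≤ e / ratDegree n d) := fun e => by
    rw [Multiset.countP_map, Multiset.countP_eq_card_filter]
    simp only [Nat.le_div_iff_mul_le hG, mul_comm]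
  rw [HasRightMinimalIndices, HasRightMinimalIndices, hasMinimalIndices_iff, hasMinimalIndices_iff]
  simp only [hcount, finrank_polySpan_transf hcop hG hP]
  refine ⟨fun h e => h _, fun h e => ?_⟩
  -- The bounds G e already recover every count for P.
  have := h (ratDegree n d * e)
  rwa [Nat.mul_div_cancel_left _ hG] at this

theorem exists_hasMinimalIndices (V : Submodule (RatFunc F) (Fin p → RatFunc F)) :
    ∃ β, HasMinimalIndices V β :=
  let ⟨s, v, hv⟩ := exists_isMinimalBasis V
  ⟨_, s, v, hv, rfl⟩

theorem HasMinimalIndices.unique {V : Submodule (RatFunc F) (Fin p → RatFunc F)}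
    {β β' : Multiset ℕ} (h : HasMinimalIndices V β) (h' : HasMinimalIndices V β') : β = β' := by
  rw [hasMinimalIndices_iff] at h h'
  exact eq_of_countP_le_eq fun e => by rw [h, h']

theorem exists_eq_map_of_hasRightMinimalIndices_transf (hcop : IsCoprime n d)
    (hG : 1 ≤ ratDegree n d) {g : ℕ} {P : Matrix (Fin m) (Fin p) F[X]} (hP : HasGrade P g)
    {ε : Multiset ℕ} (hε : HasRightMinimalIndices (transf g n d P) ε) :
    ∃ β : Multiset ℕ, ε = β.map (fun b => ratDegree n d * b) ∧ HasRightMinimalIndices P β := by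
  obtain ⟨β, hβ⟩ := exists_hasMinimalIndices (ratKer P)
  exact ⟨β, HasMinimalIndices.unique hε
    ((hasRightMinimalIndices_transf_iff hcop hG hP β).mp hβ), hβ⟩

end TransfKernel

end

end RatTransf

theorem theorem4p1 {F : Type*} [Field F] (m p g : ℕ) (n d : Polynomial F)
    (hcop : IsCoprime n d) (G : ℕ) (hG : G = RatTransf.ratDegree n d) (hG1 : 1 ≤ G)
    (P : Matrix (Fin m) (Fin p) (Polynomial F)) (hP : RatTransf.HasGrade P g)
    (Q : Matrix (Fin m) (Fin p) (Polynomial F)) (hQ : Q = RatTransf.transf g n d P) :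
    -- `g G` is a grade of `Q`
    RatTransf.HasGrade Q (g * G) ∧
    -- from `P` to `Q`
    (∀ x₀ y₀ : OnePoint F, RatTransf.MemFiber n d x₀ y₀ →
      (RatTransf.IsCharacteristicValue P g x₀ → RatTransf.IsCharacteristicValue Q (g * G) y₀) ∧
      ∀ ℓ : Multiset ℕ, RatTransf.HasElementaryDivisors P g x₀ ℓ →
        RatTransf.HasElementaryDivisors Q (g * G) y₀
          (ℓ.map fun l => RatTransf.fiberMultiplicity n d x₀ y₀ * l)) ∧
    -- from `Q` to `P`
    (∀ x₀ y₀ : OnePoint F, x₀ = RatTransf.ratValue n d y₀ →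
      RatTransf.MemFiber n d x₀ y₀ ∧
      (RatTransf.IsCharacteristicValue Q (g * G) y₀ → RatTransf.IsCharacteristicValue P g x₀) ∧
      ∀ κ : Multiset ℕ, RatTransf.HasElementaryDivisors Q (g * G) y₀ κ →
        (∀ k ∈ κ, RatTransf.fiberMultiplicity n d x₀ y₀ ∣ k) ∧
        RatTransf.HasElementaryDivisors P g x₀
          (κ.map fun k => k / RatTransf.fiberMultiplicity n d x₀ y₀)) ∧
    -- right minimal indices
    (∀ β : Multiset ℕ, RatTransf.HasRightMinimalIndices P β ↔
      RatTransf.HasRightMinimalIndices Q (β.map fun b => G * b)) ∧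
    (∀ ε : Multiset ℕ, RatTransf.HasRightMinimalIndices Q ε →
      ∃ β : Multiset ℕ, ε = β.map (fun b => G * b) ∧ RatTransf.HasRightMinimalIndices P β) ∧
    -- left minimal indices
    (∀ γ : Multiset ℕ, RatTransf.HasLeftMinimalIndices P γ ↔
      RatTransf.HasLeftMinimalIndices Q (γ.map fun c => G * c)) ∧
    (∀ η : Multiset ℕ, RatTransf.HasLeftMinimalIndices Q η →
      ∃ γ : Multiset ℕ, η = γ.map (fun c => G * c) ∧ RatTransf.HasLeftMinimalIndices P γ) := by
  subst hG hQ
  have hT : RatTransf.HasGrade P.transpose g := fun i j => hP j i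
  -- The transform acts entrywise, so the left indices are the right indices of the transpose.
  have hQT : (RatTransf.transf g n d P).transpose = RatTransf.transf g n d P.transpose := rfl
  refine ⟨fun i j => RatTransf.natDegree_transfPoly_le g n d (P i j), ?_, ?_,
    RatTransf.hasRightMinimalIndices_transf_iff hcop hG1 hP,
    fun ε => RatTransf.exists_eq_map_of_hasRightMinimalIndices_transf hcop hG1 hP,
    RatTransf.hasRightMinimalIndices_transf_iff hcop hG1 hT,
    fun η => RatTransf.exists_eq_map_of_hasRightMinimalIndices_transf hcop hG1 hT⟩
  · intro x₀ y₀ hmem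
    obtain rfl := (RatTransf.memFiber_iff hG1 x₀ y₀).mp hmem
    obtain ⟨L₀, hL, hL'⟩ := RatTransf.exists_elementaryDivisors hcop hG1 hP y₀
    refine ⟨?_, fun ℓ hℓ => ?_⟩
    · rintro ⟨L, h, hne⟩
      obtain rfl := (hL L).mp h
      exact ⟨_, (hL' _).mpr rfl, by simpa using hne⟩
    · obtain rfl := (hL ℓ).mp hℓ
      exact (hL' _).mpr rfl
  · rintro x₀ y₀ rfl
    have hmem := (RatTransf.memFiber_iff hG1 (RatTransf.ratValue n d y₀) y₀).mpr rfl
    have hpos := RatTransf.fiberMultiplicity_pos hcop hG1 hmem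
    obtain ⟨L₀, hL, hL'⟩ := RatTransf.exists_elementaryDivisors hcop hG1 hP y₀
    refine ⟨hmem, ?_, fun κ hκ => ?_⟩
    · rintro ⟨L, h, hne⟩
      obtain rfl := (hL' L).mp h
      exact ⟨_, (hL _).mpr rfl, by simpa using hne⟩
    · obtain rfl := (hL' κ).mp hκ
      refine ⟨fun k hk => ?_, (hL _).mpr ?_⟩
      · obtain ⟨l, -, rfl⟩ := Multiset.mem_map.mp hk
        exact dvd_mul_right _ _
      · simp [Multiset.map_map, Nat.mul_div_cancel_left _ hpos]
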